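/- Let $\mathrm{ham}(a,b)$ denote the Hamming distance of $a,b\in\Sigma^d$, i.e. the number of coordinates in which they differ. For points $p_1,\dots,p_n\in\Sigma^d$ (repetitions allowed), the cost of a spanning tree $T$ of the complete graph on $\{1,\dots,n\}$ is $\sum_{\{i,j\}\in T}\mathrm{ham}(p_i,p_j)$, and a minimum spanning tree is a spanning tree of minimum cost. The model of computation is the randomized unit-cost word RAM: a fixed program works on $w$-bit words, where $w\ge c\log_2(nd|\Sigma|)+c$ for a constant $c$, with the usual arithmetic, bitwise, comparison and memory operations, and it can draw a uniformly random word in one step. In time bounds, $\lg x$ stands for $\max(1,\log_2 x)$. There is an absolute constant $C$ such that the following holds. For every constant $\alpha\ge 1$ there is a randomized word-RAM program (and a constant $c$ for its word size) such that for every finite alphabet $\Sigma=\{0,\dots,s-1\}$ there is a constant $K$, depending only on $\alpha$ and $s=|\Sigma|$, with the following property. Given any $n\ge 1$, $d\ge 1$ and points $p_1,\dots,p_n\in\Sigma^d$, the program always halts within $$K\cdot\lg(nd)\,\bigl(nd\,\lg d+n^2\,\lg\lg d\bigr)$$ steps and outputs a spanning tree of the points; with probability at least $1-1/(nd)^{\alpha}$,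 the cost of this tree is at most $C(\log_2|\Sigma|+1)$ times the cost of a minimum spanning tree of the points. In particular, for an alphabet of size $O(1)$, the time is $O(\log(nd)(nd\log d+n^2\log\log d))$. -/

import Mathlib

/-! ### A randomized word RAM with step counting

Words are the numbers `0, …, 2 ^ w - 1`. Programs are finite, structured (sequence, branch, loop),
and do not depend on the input or on `w`. Every executed instruction, every test and every node of
an evaluated expression is charged one step. -/

namespace WordRAM

/-- The binary operations on words: arithmetic modulo `2 ^ w`, division with remainder, bitwise
operations, shifts and comparisons (with value `1` for true and `0` for false). -/
inductive Op
  | add | sub | mul | div | mod | and | or | xor | shl | shr | lt | eq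

/-- The value of an operation on two `w`-bit words. -/
def Op.eval (w : ℕ) : Op → ℕ → ℕ → ℕ
  | .add, a, b => (a + b) % 2 ^ w
  | .sub, a, b => (a + (2 ^ w - b % 2 ^ w)) % 2 ^ w
  | .mul, a, b => (a * b) % 2 ^ w
  | .div, a, b => (a / b) % 2 ^ w
  | .mod, a, b => (a % b) % 2 ^ w
  | .and, a, b => (a &&& b) % 2 ^ w
  | .or, a, b => (a ||| b) % 2 ^ w
  | .xor, a, b => (a ^^^ b) % 2 ^ w
  | .shl, a, b => (a * 2 ^ b) % 2 ^ w
  | .shr, a, b => (a / 2 ^ b) % 2 ^ w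
  | .lt, a, b => if a < b then 1 % 2 ^ w else 0
  | .eq, a, b => if a = b then 1 % 2 ^ w else 0

/-- Expressions: literals, registers, memory cells with a computed address, operations. -/
inductive Expr
  | lit (c : ℕ)
  | reg (r : ℕ)
  | load (addr : Expr)
  | op (o : Op) (e₁ e₂ : Expr)

/-- The machine state: registers, memory, and the number of random words drawn so far. -/
structure State where
  reg : ℕ → ℕ
  mem : ℕ → ℕ
  drawn : ℕ

/-- The value of an expression. -/
def Expr.eval (w : ℕ) (σ : State) : Expr → ℕ
  | .lit c => c % 2 ^ w
  | .reg r => σ.reg r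
  | .load a => σ.mem (a.eval w σ)
  | .op o e₁ e₂ => o.eval w (e₁.eval w σ) (e₂.eval w σ)

/-- The number of steps needed to evaluate an expression. -/
def Expr.cost : Expr → ℕ
  | .lit _ => 1
  | .reg _ => 1
  | .load a => a.cost + 1
  | .op _ e₁ e₂ => e₁.cost + e₂.cost + 1

/-- Programs. -/
inductive Program
  | skip
  | set (r : ℕ) (e : Expr)
  | store (addr e : Expr)
  | rand (r : ℕ)
  | seq (P Q : Program)
  | ite (e : Expr) (P Q : Program)
  | while (e : Expr) (P : Program)

/-- `Exec w ω P σ σ' t`: on `w`-bit words and with the random tape `ω`, the program `P` started in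
the state `σ` halts in the state `σ'` after exactly `t` steps. -/
inductive Exec (w : ℕ) (ω : ℕ → Fin (2 ^ w)) : Program → State → State → ℕ → Prop
  | skip (σ : State) : Exec w ω .skip σ σ 1
  | set (σ : State) (r : ℕ) (e : Expr) :
      Exec w ω (.set r e) σ { σ with reg := Function.update σ.reg r (e.eval w σ) } (e.cost + 1)
  | store (σ : State) (a e : Expr) :
      Exec w ω (.store a e) σ
        { σ with mem := Function.update σ.mem (a.eval w σ) (e.eval w σ) } (a.cost + e.cost + 1)
  | rand (σ : State) (r : ℕ) :
      Exec w ω (.rand r) σ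
        { σ with reg := Function.update σ.reg r (ω σ.drawn : ℕ), drawn := σ.drawn + 1 } 1
  | seq {P Q : Program} {σ₁ σ₂ σ₃ : State} {t₁ t₂ : ℕ} :
      Exec w ω P σ₁ σ₂ t₁ → Exec w ω Q σ₂ σ₃ t₂ → Exec w ω (.seq P Q) σ₁ σ₃ (t₁ + t₂)
  | ite_true {e : Expr} {P Q : Program} {σ σ' : State} {t : ℕ} :
      e.eval w σ ≠ 0 → Exec w ω P σ σ' t → Exec w ω (.ite e P Q) σ σ' (e.cost + 1 + t)
  | ite_false {e : Expr} {P Q : Program} {σ σ' : State} {t : ℕ} :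
      e.eval w σ = 0 → Exec w ω Q σ σ' t → Exec w ω (.ite e P Q) σ σ' (e.cost + 1 + t)
  | while_true {e : Expr} {P : Program} {σ₁ σ₂ σ₃ : State} {t₁ t₂ : ℕ} :
      e.eval w σ₁ ≠ 0 → Exec w ω P σ₁ σ₂ t₁ → Exec w ω (.while e P) σ₂ σ₃ t₂ →
      Exec w ω (.while e P) σ₁ σ₃ (e.cost + 1 + t₁ + t₂)
  | while_false {e : Expr} {P : Program} {σ : State} :
      e.eval w σ = 0 → Exec w ω (.while e P) σ σ (e.cost + 1)

/-- The law of the random tape: independent uniformly distributed `w`-bit words. -/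
noncomputable def tapeLaw (w : ℕ) : MeasureTheory.Measure (ℕ → Fin (2 ^ w)) :=
  MeasureTheory.Measure.infinitePi fun _ => (PMF.uniformOfFintype (Fin (2 ^ w))).toMeasure

end WordRAM

namespace HammingMST

/-- The start state for the points `p 0, …, p (n - 1)` of the generalized Hamming space of
dimension `d` over the alphabet `{0, …, s - 1}`: the registers `0, 1, 2` hold `n`, `d`, `s`, the
memory cell `i * d + j` holds the `j`-th coordinate of `p i`, everything else is `0`. -/
def input (w : ℕ) {n d s : ℕ} (p : Fin n → Fin d → Fin s) : WordRAM.State where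
  reg := fun r => (if r = 0 then n else if r = 1 then d else if r = 2 then s else 0) % 2 ^ w
  mem := fun a =>
    if h : a < n * d then
      (p ⟨a / d, Nat.div_lt_of_lt_mul (by rwa [Nat.mul_comm] at h)⟩
        ⟨a % d, Nat.mod_lt _ (Nat.pos_of_ne_zero fun h0 => by simp [h0] at h)⟩ : ℕ) % 2 ^ w
    else 0
  drawn := 0

/-- The graph on the indices of the points that a final state describes: its edges are the pairs
held by the memory cells `2 * i` and `2 * i + 1` for `i < n - 1`. -/
def output (n : ℕ) (σ : WordRAM.State) : SimpleGraph (Fin n) :=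
  SimpleGraph.fromRel fun u v => ∃ i < n - 1, σ.mem (2 * i) = u ∧ σ.mem (2 * i + 1) = v

/-- The Hamming length of an edge. -/
def edgeLength {n d s : ℕ} (p : Fin n → Fin d → Fin s) : Sym2 (Fin n) → ℕ :=
  Sym2.lift ⟨fun i j => hammingDist (p i) (p j), fun i j => hammingDist_comm (p i) (p j)⟩

open Classical in
/-- The cost of a graph on the points: the sum of the Hamming lengths of its edges. -/
noncomputable def cost {n d s : ℕ} (p : Fin n → Fin d → Fin s) (T : SimpleGraph (Fin n)) : ℕ :=
  ∑ e ∈ T.edgeFinset, edgeLength p e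

/-- `M` is a minimum spanning tree of the points `p`. -/
def IsMinSpanningTree {n d s : ℕ} (p : Fin n → Fin d → Fin s) (M : SimpleGraph (Fin n)) : Prop :=
  M.IsTree ∧ ∀ T : SimpleGraph (Fin n), T.IsTree → cost p M ≤ cost p T

/-- `T` is a spanning tree of the points `p` whose cost is within the factor `ρ` of the cost of a
minimum spanning tree. -/
def IsApproxSpanningTree {n d s : ℕ} (p : Fin n → Fin d → Fin s) (ρ : ℝ)
    (T : SimpleGraph (Fin n)) : Prop :=
  T.IsTree ∧ ∃ M, IsMinSpanningTree p M ∧ (cost p T : ℝ) ≤ ρ * cost p M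

/-- The binary logarithm inside a time bound, replaced by `1` where it is smaller than `1`. -/
noncomputable def lg (x : ℝ) : ℝ := max 1 (Real.logb 2 x)

/-- The time bound `log (n d) * (n d log d + n² log log d)`. -/
noncomputable def timeBound (n d : ℕ) : ℝ :=
  lg (n * d) * (n * d * lg d + (n : ℝ) ^ 2 * lg (lg d))

end HammingMST

/-! ### Total correctness rules with time bounds -/

namespace WordRAM

open Function

variable {w : ℕ} {ω : ℕ → Fin (2 ^ w)} {σ : State} {P P' : Program} {Q Q' R : State → Prop}
  {T T' T₁ T₂ : ℕ} {e e₁ e₂ : Expr} {r a b v : ℕ}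

/-! Encode a point by the 0/1 vector indexed by the pairs (coordinate, letter). The vectors of two
points at Hamming distance h differ by a vector c with entries in {-1, 0, 1}, entry sum 0 and square
sum 2h. A uniformly random set of pairs projects each point to the sum of its selected entries. The
difference of two projections is half a Rademacher sum of c, so its square has expectation h/2. The
program adds up these squares over m = A(⌊log₂(nd)⌋ + 1) independent rounds. The total W satisfies
mh ≤ 8W and W ≤ 2mh, each with failure probability at most exp(-m/16) (`tapeLaw_estimate_lt_le`,
`tapeLaw_estimate_gt_le`). Both tails are Chernoff bounds for exp(±X²/L) with X the Rademacher sum;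
the moments are bounded by induction on the number of signs (`sum_exp_sq_le`, `sum_exp_neg_sq_le`).
For A ≥ 16(α + 3) a union bound over the n² ordered pairs leaves at most (nd)^(-α) (`failure_le`).

Prim's algorithm is then run on the weights W. It produces a spanning tree whatever the weights are,
which gives the claims made for every tape (`output_isTree`). The tree is minimal for W
(`sum_outEdge_le`), so if all estimates are good its true cost exceeds the minimum by a factor of at
most 8 · 2 = 16 (`cost_output_le`). Thus C = 16 works, and the factor log₂ s + 1 matters only
through being at least 1.

A round takes O(ds + nd + n²) steps and Prim's algorithm O(n²). The total O(m(ds + nd + n²)) is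
within the time bound since ds ≤ s · nd and every `lg` is at least 1. The rest is verification of
the program by loop invariants, including that no intermediate value overflows a word. -/

theorem Expr.eval_lit (h : a < 2 ^ w) : (Expr.lit a).eval w σ = a := Nat.mod_eq_of_lt h

theorem Expr.eval_reg (h : σ.reg r = v) : (Expr.reg r).eval w σ = v := h

theorem Expr.eval_load (h : e.eval w σ = a) : (Expr.load e).eval w σ = σ.mem a := by
  simp only [Expr.eval, h]

theorem Expr.eval_add (h₁ : e₁.eval w σ = a) (h₂ : e₂.eval w σ = b) (h : a + b < 2 ^ w) :
    (Expr.op .add e₁ e₂).eval w σ = a + b := by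
  simp only [Expr.eval, Op.eval, h₁, h₂, Nat.mod_eq_of_lt h]

theorem Expr.eval_mul (h₁ : e₁.eval w σ = a) (h₂ : e₂.eval w σ = b) (h : a * b < 2 ^ w) :
    (Expr.op .mul e₁ e₂).eval w σ = a * b := by
  simp only [Expr.eval, Op.eval, h₁, h₂, Nat.mod_eq_of_lt h]

theorem Expr.eval_sub (h₁ : e₁.eval w σ = a) (h₂ : e₂.eval w σ = b) (h : b ≤ a) (ha : a < 2 ^ w) :
    (Expr.op .sub e₁ e₂).eval w σ = a - b := by
  have hb : b < 2 ^ w := h.trans_lt ha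
  simp only [Expr.eval, Op.eval, h₁, h₂, Nat.mod_eq_of_lt hb]
  rw [show a + (2 ^ w - b) = a - b + 2 ^ w by omega, Nat.add_mod_right, Nat.mod_eq_of_lt (by omega)]

theorem Expr.eval_div (h₁ : e₁.eval w σ = a) (h₂ : e₂.eval w σ = b) (h : a < 2 ^ w) :
    (Expr.op .div e₁ e₂).eval w σ = a / b := by
  simp only [Expr.eval, Op.eval, h₁, h₂, Nat.mod_eq_of_lt ((Nat.div_le_self a b).trans_lt h)]

theorem Expr.eval_mod (h₁ : e₁.eval w σ = a) (h₂ : e₂.eval w σ = b) (h : a < 2 ^ w) :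
    (Expr.op .mod e₁ e₂).eval w σ = a % b := by
  simp only [Expr.eval, Op.eval, h₁, h₂, Nat.mod_eq_of_lt ((Nat.mod_le a b).trans_lt h)]

theorem Expr.eval_lt_ne_zero (h₁ : e₁.eval w σ = a) (h₂ : e₂.eval w σ = b) (hw : 1 < 2 ^ w) :
    (Expr.op .lt e₁ e₂).eval w σ ≠ 0 ↔ a < b := by
  simp only [Expr.eval, Op.eval, h₁, h₂, Nat.mod_eq_of_lt hw]
  split_ifs <;> simp_all

/-- Started in `σ`, the program `P` halts within `T` steps in a state with the property `Q`. -/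
def Runs (w : ℕ) (ω : ℕ → Fin (2 ^ w)) (P : Program) (σ : State) (Q : State → Prop) (T : ℕ) :
    Prop :=
  ∃ σ' t, Exec w ω P σ σ' t ∧ Q σ' ∧ t ≤ T

theorem Runs.mono (h : Runs w ω P σ Q T) (hQ : ∀ σ', Q σ' → Q' σ') (hT : T ≤ T') :
    Runs w ω P σ Q' T' := by
  obtain ⟨σ', t, h, hq, ht⟩ := h
  exact ⟨σ', t, h, hQ _ hq, ht.trans hT⟩

theorem Runs.seq (h₁ : Runs w ω P σ R T₁) (h₂ : ∀ σ', R σ' → Runs w ω P' σ' Q T₂) :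
    Runs w ω (.seq P P') σ Q (T₁ + T₂) := by
  obtain ⟨σ', t, h, hq, ht⟩ := h₁
  obtain ⟨σ'', t', h', hq', ht'⟩ := h₂ σ' hq
  exact ⟨σ'', _, .seq h h', hq', by omega⟩

theorem Runs.skip (hQ : Q σ) : Runs w ω .skip σ Q 1 := ⟨_, _, .skip σ, hQ, le_rfl⟩

theorem Runs.set (he : e.eval w σ = v) (hQ : Q { σ with reg := update σ.reg r v }) :
    Runs w ω (.set r e) σ Q (e.cost + 1) :=
  ⟨_, _, .set σ r e, by rwa [he], le_rfl⟩

theorem Runs.store (h₁ : e₁.eval w σ = a) (h₂ : e₂.eval w σ = v)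
    (hQ : Q { σ with mem := update σ.mem a v }) :
    Runs w ω (.store e₁ e₂) σ Q (e₁.cost + e₂.cost + 1) :=
  ⟨_, _, .store σ e₁ e₂, by rwa [h₁, h₂], le_rfl⟩

theorem Runs.rand
    (hQ : Q { σ with reg := update σ.reg r (ω σ.drawn : ℕ), drawn := σ.drawn + 1 }) :
    Runs w ω (.rand r) σ Q 1 :=
  ⟨_, _, .rand σ r, hQ, le_rfl⟩

theorem Runs.ite (h₁ : e.eval w σ ≠ 0 → Runs w ω P σ Q T) (h₂ : e.eval w σ = 0 → Runs w ω P' σ Q T) :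
    Runs w ω (.ite e P P') σ Q (e.cost + 1 + T) := by
  by_cases h : e.eval w σ = 0
  · obtain ⟨σ', t, h', hq, ht⟩ := h₂ h
    exact ⟨σ', _, .ite_false h h', hq, by omega⟩
  · obtain ⟨σ', t, h', hq, ht⟩ := h₁ h
    exact ⟨σ', _, .ite_true h h', hq, by omega⟩

/-- The invariant is indexed by the iteration and forces exactly N of them, so termination and the
time bound come out together, by induction on the number of remaining iterations. -/
theorem Runs.while (I : ℕ → State → Prop) (N T : ℕ) (h₀ : I 0 σ)
    (step : ∀ i < N, ∀ σ, I i σ → e.eval w σ ≠ 0 ∧ Runs w ω P σ (I (i + 1)) T)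
    (hhalt : ∀ σ, I N σ → e.eval w σ = 0) :
    Runs w ω (.while e P) σ (I N) (N * (T + e.cost + 1) + e.cost + 1) := by
  have key : ∀ k i, i + k = N → ∀ σ, I i σ →
      Runs w ω (.while e P) σ (I N) (k * (T + e.cost + 1) + e.cost + 1) := by
    intro k
    induction k with
    | zero =>
      rintro i rfl σ hσ
      exact ⟨σ, _, .while_false (hhalt σ hσ), hσ, by omega⟩
    | succ k ih =>
      intro i hi σ hσ
      obtain ⟨he, σ', t, h, hq, ht⟩ := step i (by omega) σ hσ
      obtain ⟨σ'', t', h', hq', ht'⟩ := ih (i + 1) (by omega) σ' hq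
      refine ⟨σ'', _, .while_true he h h', hq', ?_⟩
      rw [Nat.add_mul]
      omega
  exact key N 0 (by omega) σ h₀

/-- Run `P` with the register `r` holding `0, 1, …` up to the value of the register `rb`. -/
def Program.forLt (r rb : ℕ) (P : Program) : Program :=
  .seq (.set r (.lit 0)) (.while (.op .lt (.reg r) (.reg rb))
    (.seq P (.set r (.op .add (.reg r) (.lit 1)))))

/-- The invariant must not depend on the counter register (`hI`), because the loop itself overwrites
it. An iteration adds 4 steps for the increment and 4 for the test to the body. -/
theorem Runs.forLt {rb : ℕ} (I : ℕ → State → Prop) (N T : ℕ) (hN : N < 2 ^ w) (hw : 1 < 2 ^ w)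
    (hI : ∀ i σ v, I i σ → I i { σ with reg := update σ.reg r v })
    (hb : ∀ i σ, I i σ → σ.reg rb = N) (h₀ : I 0 σ)
    (step : ∀ i < N, ∀ σ, I i σ → σ.reg r = i →
      Runs w ω P σ (fun σ' => I (i + 1) σ' ∧ σ'.reg r = i) T) :
    Runs w ω (.forLt r rb P) σ (I N) (N * (T + 8) + 6) := by
  refine Runs.mono (T := (Expr.lit 0).cost + 1 + (N * (T + 4 + 3 + 1) + 3 + 1)) (.seq
    (R := fun σ => I 0 σ ∧ σ.reg r = 0)
    (.set (Expr.eval_lit (by omega)) ⟨hI _ _ _ h₀, by simp⟩) fun σ₁ h₁ =>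
    Runs.mono (.while (e := .op .lt (.reg r) (.reg rb)) (fun i σ => I i σ ∧ σ.reg r = i)
      N (T + 4) h₁ ?_ ?_) (fun _ h => h.1) le_rfl) (fun _ h => h) ?_
  · rintro i hi σ ⟨hσ, hr⟩
    refine ⟨(Expr.eval_lt_ne_zero (Expr.eval_reg hr) (Expr.eval_reg (hb i σ hσ)) hw).2 hi,
      .seq (step i hi σ hσ hr) fun σ' h => ?_⟩
    exact .set (e := .op .add (.reg r) (.lit 1))
      (Expr.eval_add (Expr.eval_reg h.2) (Expr.eval_lit hw) (by omega)) ⟨hI _ _ _ h.1, by simp⟩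
  · rintro σ ⟨hσ, hr⟩
    by_contra h
    exact absurd ((Expr.eval_lt_ne_zero (Expr.eval_reg hr) (Expr.eval_reg (hb N σ hσ)) hw).1 h)
      (lt_irrefl _)
  · simp only [Expr.cost]
    rw [show T + 4 + 3 + 1 = T + 8 from rfl]
    omega

end WordRAM

/-! ### Memory blocks and the set-up phase -/

namespace WordRAM

open Function Finset

/-- Overwrite the cells `lo, …, lo + len - 1` with the values of `f`. -/
def fill (M : ℕ → ℕ) (lo len : ℕ) (f : ℕ → ℕ) (a : ℕ) : ℕ :=
  if lo ≤ a ∧ a < lo + len then f (a - lo) else M a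

theorem fill_of_lt {M f : ℕ → ℕ} {lo len a : ℕ} (h : a < lo) : fill M lo len f a = M a :=
  if_neg (by omega)

theorem fill_of_ge {M f : ℕ → ℕ} {lo len a : ℕ} (h : lo + len ≤ a) : fill M lo len f a = M a :=
  if_neg (by omega)

theorem fill_add {M f : ℕ → ℕ} {lo len q : ℕ} (h : q < len) : fill M lo len f (lo + q) = f q := by
  rw [fill, if_pos (by omega), Nat.add_sub_cancel_left]

theorem fill_zero {M f : ℕ → ℕ} {lo : ℕ} : fill M lo 0 f = M := by
  funext a
  exact if_neg (by omega)

/-- The induction step of every loop that writes an array from left to right. -/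
theorem fill_succ {M f : ℕ → ℕ} {lo len v : ℕ} (h : v = f len) :
    update (fill M lo len f) (lo + len) v = fill M lo (len + 1) f := by
  subst h
  funext a
  by_cases ha : a = lo + len
  · subst ha
    rw [update_self, fill_add (by omega)]
  · rw [update_of_ne ha]
    unfold fill
    split_ifs <;> first | rfl | omega

theorem mul_add_lt {i n j m : ℕ} (hi : i < n) (hj : j < m) : i * m + j < n * m := by
  have : (i + 1) * m ≤ n * m := Nat.mul_le_mul_right m hi
  rw [Nat.add_mul] at this
  omega

/-- The registers below `16` hold the parameters of the input, the number of rounds and the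
addresses of the work areas, and the word size is large enough for all the values that occur. -/
structure Layout (A n d s w : ℕ) (c : ℕ → ℕ) : Prop where
  one_le_n : 1 ≤ n
  c0 : c 0 = n
  c1 : c 1 = d
  c2 : c 2 = s
  c3 : c 3 = d * s
  c4 : c 4 = A * (Nat.log 2 (n * d) + 1)
  c5 : c 5 = n * d + 2 * n
  c6 : c 6 = c 5 + d * s
  c7 : c 7 = c 6 + n
  c8 : c 8 = c 7 + n * n
  c9 : c 9 = c 8 + n
  c10 : c 10 = n * n
  c11 : c 11 = n - 1
  one_lt : 1 < 2 ^ w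
  addr_lt : c 9 + n < 2 ^ w
  two_mul_lt : 2 * (d * d) < 2 ^ w
  dist_lt : c 4 * (d * d) + 2 < 2 ^ w
  rounds_lt : c 4 < 2 ^ w

theorem Layout.congr {A n d s w : ℕ} {c c' : ℕ → ℕ} (h : Layout A n d s w c)
    (hc : ∀ r < 16, c' r = c r) : Layout A n d s w c' := by
  obtain ⟨_, _, _, _, _, _, _, _, _, _, _, _, _, _, _, _, _, _⟩ := h
  constructor <;> (try simp only [hc, Nat.reduceLT]) <;> assumption

/-- Compute the number of rounds, which is `A` times the bit length of `n * d`, and the addresses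
of the work areas. -/
def setup (A : ℕ) : Program :=
  .seq (.set 3 (.op .mul (.reg 1) (.reg 2))) <|
  .seq (.set 12 (.op .mul (.reg 0) (.reg 1))) <|
  .seq (.set 4 (.lit 0)) <|
  .seq (.while (.reg 12)
    (.seq (.set 12 (.op .div (.reg 12) (.lit 2))) (.set 4 (.op .add (.reg 4) (.lit 1))))) <|
  .seq (.set 4 (.op .mul (.lit A) (.reg 4))) <|
  .seq (.set 5 (.op .add (.op .mul (.reg 0) (.reg 1)) (.op .mul (.lit 2) (.reg 0)))) <|
  .seq (.set 6 (.op .add (.reg 5) (.reg 3))) <|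
  .seq (.set 7 (.op .add (.reg 6) (.reg 0))) <|
  .seq (.set 10 (.op .mul (.reg 0) (.reg 0))) <|
  .seq (.set 8 (.op .add (.reg 7) (.reg 10))) <|
  .seq (.set 9 (.op .add (.reg 8) (.reg 0))) <|
  .set 11 (.op .sub (.reg 0) (.lit 1))

theorem log_succ_le {x : ℕ} (hx : 1 ≤ x) : Nat.log 2 x + 1 ≤ x :=
  Nat.log_lt_self 2 (by omega)

/-- Registers 5 to 9 point to consecutive areas: random bits (d * s cells), projections (n),
estimates (n * n), keys (n) and parents (n). They start at n * d + 2 * n, hence above both the input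
and the output cells, which overlap each other. All values that occur are bounded by multiples of
the cube of n * d * s, which is what the word size provides for. -/
theorem runs_setup {A n d s w : ℕ} {ω : ℕ → Fin (2 ^ w)} {σ : State} (hn : 1 ≤ n) (hd : 1 ≤ d)
    (hs : 1 ≤ s) (hA : 1 ≤ A) (hw : (A + 20) * (n * d * s) ^ 3 ≤ 2 ^ w) (h0 : σ.reg 0 = n)
    (h1 : σ.reg 1 = d) (h2 : σ.reg 2 = s) :
    Runs w ω (setup A) σ
      (fun σ' => Layout A n d s w σ'.reg ∧ σ'.mem = σ.mem ∧ σ'.drawn = σ.drawn)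
      ((Nat.log 2 (n * d) + 1) * 10 + 50) := by
  have hN : 1 ≤ n * d * s := Nat.mul_pos (Nat.mul_pos hn hd) hs
  have hnd : 1 ≤ n * d := Nat.mul_pos hn hd
  set N := n * d * s with hNdef
  have hndN : n * d ≤ N := Nat.le_mul_of_pos_right _ hs
  have hnN : n ≤ N := (Nat.le_mul_of_pos_right _ hd).trans hndN
  have hdN : d ≤ N := (Nat.le_mul_of_pos_left _ hn).trans hndN
  have hdsN : d * s ≤ N := by
    rw [hNdef, Nat.mul_assoc]; exact Nat.le_mul_of_pos_left _ hn
  have hN1 : N ≤ N ^ 3 := Nat.le_self_pow (by norm_num) N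
  have hN2 : N ^ 2 ≤ N ^ 3 := Nat.pow_le_pow_right hN (by norm_num)
  have hnn : n * n ≤ N ^ 3 := (by nlinarith : n * n ≤ N ^ 2).trans hN2
  have hdd : d * d ≤ N ^ 2 := by nlinarith
  have hl := log_succ_le hnd
  set l := Nat.log 2 (n * d) + 1 with hldef
  have hAl : A * l ≤ A * N ^ 3 := Nat.mul_le_mul_left A (by omega)
  have hldd : A * l * (d * d) ≤ A * N ^ 3 := by
    rw [Nat.mul_assoc]
    refine Nat.mul_le_mul_left A ?_
    calc l * (d * d) ≤ N * N ^ 2 := Nat.mul_le_mul (by omega) hdd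
      _ = N ^ 3 := by ring
  have hA3 : A ≤ A * N ^ 3 := Nat.le_mul_of_pos_right _ (by omega)
  have hAl0 : A * 0 ≤ A * l := Nat.mul_le_mul_left A (by omega)
  rw [Nat.add_mul] at hw
  -- One summand for each instruction; the bracket with l is the loop that halves n * d down to 0
  -- and counts its binary digits.
  refine Runs.mono (T := 4 + (4 + (2 + ((l * (4 + 4 + 1 + 1) + 1 + 1) + (4 + (8 + (4 + (4 + (4 + (4 +
    (4 + 4))))))))))) ?_ (fun _ h => h) (by omega)
  refine .seq (.set (e := .op .mul (.reg 1) (.reg 2)) (v := d * s)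
    (Expr.eval_mul h1 h2 (by omega)) rfl) ?_
  rintro _ rfl
  refine .seq (.set (e := .op .mul (.reg 0) (.reg 1)) (v := n * d)
    (Expr.eval_mul (by simpa [Expr.eval] using h0) (by simpa [Expr.eval] using h1) (by omega)) rfl)
    ?_
  rintro _ rfl
  refine .seq (.set (v := 0) (Expr.eval_lit (by omega)) rfl) ?_
  rintro _ rfl
  refine .seq (.while (fun i σ' => σ'.reg 0 = n ∧ σ'.reg 1 = d ∧ σ'.reg 2 = s ∧ σ'.reg 3 = d * s ∧
    σ'.reg 12 = n * d / 2 ^ i ∧ σ'.reg 4 = i ∧ σ'.mem = σ.mem ∧ σ'.drawn = σ.drawn) l 8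
    ?_ ?_ ?_) ?_
  · simp [h0, h1, h2]
  · rintro i hi τ ⟨t0, t1, t2, t3, t12, t4, tm, tdr⟩
    have hpow : 2 ^ i ≤ n * d :=
      (Nat.pow_le_pow_right (by norm_num) (by omega)).trans (Nat.pow_log_le_self 2 (by omega))
    refine ⟨?_, .seq (T₁ := 4) (T₂ := 4) (.set (e := .op .div (.reg 12) (.lit 2))
      (Expr.eval_div t12 (Expr.eval_lit (by omega)) ?_) rfl) ?_⟩
    · simp only [Expr.eval, t12]
      exact (Nat.div_pos hpow (by positivity)).ne'
    · exact (Nat.div_le_self _ _).trans_lt (by omega)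
    · rintro _ rfl
      refine .set (e := .op .add (.reg 4) (.lit 1))
        (Expr.eval_add (a := i) (by simpa [Expr.eval] using t4) (Expr.eval_lit (by omega))
          (by omega)) ?_
      simp [t0, t1, t2, t3, tm, tdr, Nat.div_div_eq_div_mul, pow_succ]
  · rintro τ ⟨-, -, -, -, t12, -⟩
    simp only [Expr.eval, t12]
    exact Nat.div_eq_of_lt (Nat.lt_pow_succ_log_self (by norm_num) _)
  · rintro τ ⟨t0, t1, t2, t3, -, t4, tm, tdr⟩
    refine .seq (.set (e := .op .mul (.lit A) (.reg 4)) (v := A * l)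
      (Expr.eval_mul (Expr.eval_lit (by omega)) t4 (by omega)) rfl) ?_
    rintro _ rfl
    refine .seq (.set (e := .op .add (.op .mul (.reg 0) (.reg 1)) (.op .mul (.lit 2) (.reg 0)))
      (v := n * d + 2 * n)
      (Expr.eval_add (Expr.eval_mul (by simpa [Expr.eval] using t0)
        (by simpa [Expr.eval] using t1) (by omega))
        (Expr.eval_mul (Expr.eval_lit (by omega)) (by simpa [Expr.eval] using t0) (by omega))
        (by omega)) rfl) ?_
    rintro _ rfl
    refine .seq (.set (e := .op .add (.reg 5) (.reg 3)) (v := n * d + 2 * n + d * s)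
      (Expr.eval_add (by simp [Expr.eval]) (by simpa [Expr.eval] using t3) (by omega)) rfl) ?_
    rintro _ rfl
    refine .seq (.set (e := .op .add (.reg 6) (.reg 0)) (v := n * d + 2 * n + d * s + n)
      (Expr.eval_add (by simp [Expr.eval]) (by simpa [Expr.eval] using t0) (by omega)) rfl) ?_
    rintro _ rfl
    refine .seq (.set (e := .op .mul (.reg 0) (.reg 0)) (v := n * n)
      (Expr.eval_mul (by simpa [Expr.eval] using t0) (by simpa [Expr.eval] using t0) (by omega))
      rfl) ?_
    rintro _ rfl
    refine .seq (.set (e := .op .add (.reg 7) (.reg 10)) (v := n * d + 2 * n + d * s + n + n * n)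
      (Expr.eval_add (by simp [Expr.eval]) (by simp [Expr.eval]) (by omega)) rfl) ?_
    rintro _ rfl
    refine .seq (.set (e := .op .add (.reg 8) (.reg 0))
      (v := n * d + 2 * n + d * s + n + n * n + n)
      (Expr.eval_add (by simp [Expr.eval]) (by simpa [Expr.eval] using t0) (by omega)) rfl) ?_
    rintro _ rfl
    refine .set (e := .op .sub (.reg 0) (.lit 1)) (v := n - 1)
      (Expr.eval_sub (by simpa [Expr.eval] using t0) (Expr.eval_lit (by omega)) (by omega)
        (by omega)) ?_
    refine ⟨?_, tm, tdr⟩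
    constructor <;> first | omega | (simp; done) | (simp [t0, t1, t2, t3]; done) | (simp; omega)

end WordRAM

/-! ### One round of the sketch -/

namespace WordRAM

open Function Finset

variable {A n d s w : ℕ} {ω : ℕ → Fin (2 ^ w)} {σ : State}

/-- Draw the random bits of one round. -/
def drawBits : Program :=
  .forLt 17 3 (.seq (.rand 18) (.store (.op .add (.reg 5) (.reg 17))
    (.op .mod (.reg 18) (.lit 2))))

/-- Sum up, for each point, the random bits that belong to its coordinates. -/
def project : Program :=
  .forLt 17 0 <| .seq (.set 19 (.lit 0)) <|
  .seq (.forLt 18 1 (.set 19 (.op .add (.reg 19) (.load (.op .add (.reg 5)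
    (.op .add (.op .mul (.reg 18) (.reg 2))
      (.load (.op .add (.op .mul (.reg 17) (.reg 1)) (.reg 18))))))))) <|
  .store (.op .add (.reg 6) (.reg 17)) (.reg 19)

/-- Add the squared differences of the projections to the matrix of the estimates. -/
def accumulate : Program :=
  .forLt 17 10 <| .seq (.set 18 (.load (.op .add (.reg 6) (.op .div (.reg 17) (.reg 0))))) <|
  .seq (.set 19 (.load (.op .add (.reg 6) (.op .mod (.reg 17) (.reg 0))))) <|
  .store (.op .add (.reg 7) (.reg 17)) (.op .add (.load (.op .add (.reg 7) (.reg 17)))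
    (.op .sub (.op .add (.op .mul (.reg 18) (.reg 18)) (.op .mul (.reg 19) (.reg 19)))
      (.op .mul (.lit 2) (.op .mul (.reg 18) (.reg 19)))))

/-- All rounds of the sketch. -/
def sketch : Program := .forLt 16 4 (.seq drawBits (.seq project accumulate))

/-- The square of the difference of two natural numbers. -/
def sqDiff (a b : ℕ) : ℕ := a * a + b * b - 2 * (a * b)

/-- Keeps the subtraction in `sqDiff` from being truncated, so that it agrees with the real square.
-/
theorem two_mul_le_sq (a b : ℕ) : 2 * (a * b) ≤ a * a + b * b := by
  have := two_mul_le_add_sq a b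
  nlinarith

theorem sqDiff_le {a b c : ℕ} (ha : a ≤ c) (hb : b ≤ c) : sqDiff a b ≤ c * c := by
  unfold sqDiff
  rcases le_total a b with h | h
  · have h1 : b * b ≤ c * c := Nat.mul_le_mul hb hb
    have h2 : a * a ≤ a * b := Nat.mul_le_mul_left a h
    omega
  · have h1 : a * a ≤ c * c := Nat.mul_le_mul ha ha
    have h2 : b * b ≤ a * b := Nat.mul_le_mul_right b h
    omega

theorem runs_drawBits (hσ : Layout A n d s w σ.reg) :
    Runs w ω drawBits σ (fun σ' => (∀ r < 17, σ'.reg r = σ.reg r) ∧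
      σ'.mem = fill σ.mem (σ.reg 5) (d * s) (fun q => ω (σ.drawn + q) % 2) ∧
      σ'.drawn = σ.drawn + d * s) (d * s * 16 + 6) := by
  have hb := hσ.one_lt
  have h5 := hσ.c5
  have h6 := hσ.c6
  have h7 := hσ.c7
  have h8 := hσ.c8
  have h9 := hσ.c9
  have hlt := hσ.addr_lt
  have h2w : 2 < 2 ^ w := by have := hσ.one_le_n; omega
  refine .forLt (fun i σ' => (∀ r < 17, σ'.reg r = σ.reg r) ∧
    σ'.mem = fill σ.mem (σ.reg 5) i (fun q => ω (σ.drawn + q) % 2) ∧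
    σ'.drawn = σ.drawn + i) _ 8 (by omega) hb ?_ ?_ ⟨fun _ _ => rfl, fill_zero.symm, rfl⟩ ?_
  · rintro i σ' v ⟨hr, hm, hd⟩
    exact ⟨fun r h => by simp [update_of_ne (show r ≠ 17 by omega), hr r h], hm, hd⟩
  · rintro i σ' ⟨hr, -⟩
    rw [hr 3 (by norm_num), hσ.c3]
  · rintro i hi σ' ⟨hr, hm, hd⟩ hi'
    refine .seq (T₁ := 1) (T₂ := 7) (.rand rfl) ?_
    rintro _ rfl
    refine .store (e₁ := .op .add (.reg 5) (.reg 17)) (e₂ := .op .mod (.reg 18) (.lit 2))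
      (Expr.eval_add (a := σ.reg 5) (b := i) (by simpa [Expr.eval] using hr 5 (by norm_num))
        (by simpa [Expr.eval] using hi') (by omega))
      (Expr.eval_mod (a := ω σ'.drawn) (by simp [Expr.eval]) (Expr.eval_lit h2w) (ω _).2) ?_
    refine ⟨⟨fun r h => ?_, ?_, ?_⟩, ?_⟩
    · simp [update_of_ne (show r ≠ 18 by omega), hr r h]
    · simp only [hm, hd]
      exact fill_succ rfl
    · simp [hd, Nat.add_assoc]
    · simpa using hi'

theorem runs_project (hσ : Layout A n d s w σ.reg) (hX : ∀ a < n * d, σ.mem a < s)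
    (hbit : ∀ q < d * s, σ.mem (σ.reg 5 + q) ≤ 1) :
    Runs w ω project σ (fun σ' => (∀ r < 17, σ'.reg r = σ.reg r) ∧
      σ'.mem = fill σ.mem (σ.reg 6) n
        (fun i => ∑ j ∈ range d, σ.mem (σ.reg 5 + (j * s + σ.mem (i * d + j)))) ∧
      σ'.drawn = σ.drawn) (n * (d * 24 + 21) + 6) := by
  have hb := hσ.one_lt
  have h5 := hσ.c5
  have h6 := hσ.c6
  have h7 := hσ.c7
  have h8 := hσ.c8
  have h9 := hσ.c9
  have hlt := hσ.addr_lt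
  refine Runs.mono (T := n * (2 + (d * (16 + 8) + 6 + 5) + 8) + 6) (.forLt (fun i σ' =>
    (∀ r < 17, σ'.reg r = σ.reg r) ∧ σ'.mem = fill σ.mem (σ.reg 6) i
      (fun i => ∑ j ∈ range d, σ.mem (σ.reg 5 + (j * s + σ.mem (i * d + j)))) ∧
    σ'.drawn = σ.drawn) _ (2 + (d * (16 + 8) + 6 + 5)) (by omega) hb ?_ ?_
    ⟨fun _ _ => rfl, fill_zero.symm, rfl⟩ ?_) (fun _ h => h)
      (Nat.add_le_add_right (Nat.mul_le_mul_left _ (by omega)) _)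
  · rintro i σ' v ⟨hr, hm, hd⟩
    exact ⟨fun r h => by simp [update_of_ne (show r ≠ 17 by omega), hr r h], hm, hd⟩
  · rintro i σ' ⟨hr, -⟩
    rw [hr 0 (by norm_num), hσ.c0]
  · rintro i hi σ' ⟨hr, hm, hdr⟩ hi'
    have hid : i * d + d ≤ n * d := by
      have := Nat.mul_le_mul_right d (show i + 1 ≤ n from hi)
      rwa [Nat.add_mul, Nat.one_mul] at this
    refine .seq (T₁ := 2) (.set (v := 0) (Expr.eval_lit (by omega)) rfl) ?_
    rintro _ rfl
    refine .seq (T₂ := 5) (.forLt (fun j σ'' => (∀ r < 18, σ''.reg r = σ'.reg r) ∧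
      σ''.reg 19 = ∑ j ∈ range j, σ.mem (σ.reg 5 + (j * s + σ.mem (i * d + j))) ∧
      σ''.mem = σ'.mem ∧ σ''.drawn = σ'.drawn) d 16 (by
        have : d ≤ n * d := Nat.le_mul_of_pos_left _ hσ.one_le_n
        omega) hb ?_ ?_ ?_ ?_) ?_
    · rintro j τ v ⟨tr, t19, tm, td⟩
      exact ⟨fun r h => by simp [update_of_ne (show r ≠ 18 by omega), tr r h],
        by simpa using t19, tm, td⟩
    · rintro j τ ⟨tr, -⟩
      rw [tr 1 (by norm_num), hr 1 (by norm_num), hσ.c1]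
    · exact ⟨fun r h => by simp [update_of_ne (show r ≠ 19 by omega)], by simp, rfl, rfl⟩
    · rintro j hj τ ⟨tr, t19, tm, td⟩ t18
      have hx := hX (i * d + j) (by omega)
      have hq := mul_add_lt hj hx
      have hmem : ∀ a < σ.reg 6, τ.mem a = σ.mem a := fun a ha => by
        rw [tm, hm, fill_of_lt ha]
      -- The summands are bits, so the partial sums stay at most d and cannot overflow.
      have hsum : ∑ j ∈ range j, σ.mem (σ.reg 5 + (j * s + σ.mem (i * d + j))) ≤ j := by
        refine (sum_le_card_nsmul _ _ 1 fun k hk => ?_).trans (by simp)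
        have hk := mem_range.1 hk
        exact hbit _ (mul_add_lt (by omega) (hX _ (by omega)))
      have hbq := hbit _ hq
      have hid' : d ≤ n * d := Nat.le_mul_of_pos_left _ hσ.one_le_n
      refine .set (e := .op .add (.reg 19) (.load (.op .add (.reg 5)
        (.op .add (.op .mul (.reg 18) (.reg 2))
          (.load (.op .add (.op .mul (.reg 17) (.reg 1)) (.reg 18)))))))
        (v := ∑ j ∈ range (j + 1), σ.mem (σ.reg 5 + (j * s + σ.mem (i * d + j)))) ?_ ?_
      · have e1 : (Expr.load (.op .add (.op .mul (.reg 17) (.reg 1)) (.reg 18))).eval w τ =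
            σ.mem (i * d + j) := by
          rw [Expr.eval_load (Expr.eval_add (Expr.eval_mul (a := i) (b := d) ?_ ?_ (by omega)) (Expr.eval_reg t18)
            (by omega)), hmem _ (by omega)]
          · exact (tr 17 (by norm_num)).trans hi'
          · exact (tr 1 (by norm_num)).trans ((hr 1 (by norm_num)).trans hσ.c1)
        rw [sum_range_succ, ← hmem _ (show σ.reg 5 + (j * s + σ.mem (i * d + j)) < _ by omega)]
        refine Expr.eval_add t19 (Expr.eval_load (Expr.eval_add ?_ (Expr.eval_add
          (Expr.eval_mul t18 ?_ (by omega)) e1 (by omega)) (by omega))) ?_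
        · exact (tr 5 (by norm_num)).trans (hr 5 (by norm_num))
        · exact (tr 2 (by norm_num)).trans ((hr 2 (by norm_num)).trans hσ.c2)
        · rw [hmem _ (by omega)]
          omega
      · exact ⟨⟨fun r h => by simp [update_of_ne (show r ≠ 19 by omega), tr r h],
          by simp, tm, td⟩, by simpa using t18⟩
    · rintro τ ⟨tr, t19, tm, td⟩
      refine .store (e₁ := .op .add (.reg 6) (.reg 17)) (e₂ := .reg 19)
        (Expr.eval_add (a := σ.reg 6) (b := i) ?_ ?_ (by omega)) t19 ?_
      · exact (tr 6 (by norm_num)).trans (hr 6 (by norm_num))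
      · exact (tr 17 (by norm_num)).trans hi'
      · refine ⟨⟨fun r h => ?_, ?_, ?_⟩, ?_⟩
        · exact (tr r (by omega)).trans (hr r h)
        · simp only [tm, hm]
          exact fill_succ rfl
        · exact td.trans hdr
        · exact (tr 17 (by norm_num)).trans hi'

/-- The loop runs over the flattened matrix: the index q stands for the pair (q / n, q % n). The
assumption `hW` leaves room for one more squared difference, which is at most d * d. -/
theorem runs_accumulate (hσ : Layout A n d s w σ.reg)
    (hz : ∀ i < n, σ.mem (σ.reg 6 + i) ≤ d)
    (hW : ∀ q < n * n, σ.mem (σ.reg 7 + q) + d * d < 2 ^ w) :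
    Runs w ω accumulate σ (fun σ' => (∀ r < 17, σ'.reg r = σ.reg r) ∧
      σ'.mem = fill σ.mem (σ.reg 7) (n * n) (fun q => σ.mem (σ.reg 7 + q) +
        sqDiff (σ.mem (σ.reg 6 + q / n)) (σ.mem (σ.reg 6 + q % n))) ∧
      σ'.drawn = σ.drawn) (n * n * 44 + 6) := by
  have hb := hσ.one_lt
  have h5 := hσ.c5
  have h6 := hσ.c6
  have h7 := hσ.c7
  have h8 := hσ.c8
  have h9 := hσ.c9
  have hn := hσ.one_le_n
  have hlt := hσ.addr_lt
  have hdd := hσ.two_mul_lt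
  refine .forLt (fun i σ' =>
    (∀ r < 17, σ'.reg r = σ.reg r) ∧ σ'.mem = fill σ.mem (σ.reg 7) i
      (fun q => σ.mem (σ.reg 7 + q) +
        sqDiff (σ.mem (σ.reg 6 + q / n)) (σ.mem (σ.reg 6 + q % n))) ∧
    σ'.drawn = σ.drawn) _ 36 (by omega) hb ?_ ?_
    ⟨fun _ _ => rfl, fill_zero.symm, rfl⟩ ?_
  · rintro i σ' v ⟨hr, hm, hd⟩
    exact ⟨fun r h => by simp [update_of_ne (show r ≠ 17 by omega), hr r h], hm, hd⟩
  · rintro i σ' ⟨hr, -⟩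
    rw [hr 10 (by norm_num), hσ.c10]
  · rintro q hq σ' ⟨hr, hm, hdr⟩ hq'
    have hmem : ∀ a < σ.reg 7, σ'.mem a = σ.mem a := fun a ha => by rw [hm, fill_of_lt ha]
    have hdiv : q / n < n := Nat.div_lt_of_lt_mul hq
    have hmod : q % n < n := Nat.mod_lt _ hn
    set a := σ.mem (σ.reg 6 + q / n) with ha
    set b := σ.mem (σ.reg 6 + q % n) with hb'
    have had : a ≤ d := hz _ hdiv
    have hbd : b ≤ d := hz _ hmod
    have haa : a * a ≤ d * d := Nat.mul_le_mul had had
    have hbb : b * b ≤ d * d := Nat.mul_le_mul hbd hbd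
    have hab := two_mul_le_sq a b
    have hsq := sqDiff_le had hbd
    refine .seq (T₁ := 7) (T₂ := 29)
      (.set (e := .load (.op .add (.reg 6) (.op .div (.reg 17) (.reg 0)))) (v := a) ?_ rfl) ?_
    · rw [Expr.eval_load (Expr.eval_add (Expr.eval_reg (hr 6 (by norm_num)))
        (Expr.eval_div (Expr.eval_reg hq') (Expr.eval_reg ((hr 0 (by norm_num)).trans hσ.c0)) (by omega)) (by omega)), hmem _ (by omega)]
    rintro _ rfl
    refine .seq (T₁ := 7) (T₂ := 22)
      (.set (e := .load (.op .add (.reg 6) (.op .mod (.reg 17) (.reg 0)))) (v := b) ?_ rfl) ?_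
    · rw [Expr.eval_load (Expr.eval_add (a := σ.reg 6)
        (by simpa [Expr.eval] using (hr 6 (by norm_num)))
        (Expr.eval_mod (a := q) (b := n) (by simpa [Expr.eval] using hq')
        (by simpa [Expr.eval] using ((hr 0 (by norm_num)).trans hσ.c0)) (by omega)) (by omega)),
        hmem _ (by omega)]
    rintro _ rfl
    have hWq := hW q hq
    refine .store (a := σ.reg 7 + q) (v := σ.mem (σ.reg 7 + q) + sqDiff a b)
      (e₁ := .op .add (.reg 7) (.reg 17)) (e₂ := .op .add (.load (.op .add (.reg 7) (.reg 17)))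
      (.op .sub (.op .add (.op .mul (.reg 18) (.reg 18)) (.op .mul (.reg 19) (.reg 19)))
      (.op .mul (.lit 2) (.op .mul (.reg 18) (.reg 19))))) ?_ ?_ ?_
    · exact Expr.eval_add (by simpa [Expr.eval] using (hr 7 (by norm_num)))
        (by simpa [Expr.eval] using hq') (by omega)
    · refine Expr.eval_add ?_ (Expr.eval_sub (Expr.eval_add (Expr.eval_mul (a := a) (b := a)
        (by simp [Expr.eval]) (by simp [Expr.eval]) (by omega)) (Expr.eval_mul (a := b) (b := b)
        (by simp [Expr.eval]) (by simp [Expr.eval]) (by omega)) (by omega))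
        (Expr.eval_mul (Expr.eval_lit (by omega)) (Expr.eval_mul
        (by simp [Expr.eval]) (by simp [Expr.eval]) (by omega)) (by omega)) (by omega) (by omega))
        (show _ + sqDiff a b < _ by omega)
      rw [Expr.eval_load (Expr.eval_add (a := σ.reg 7) (b := q)
        (by simpa [Expr.eval] using (hr 7 (by norm_num)))
        (by simpa [Expr.eval] using hq') (by omega))]
      simp only [hm, fill]
      rw [if_neg (by omega)]
    · refine ⟨⟨fun r h => ?_, ?_, hdr⟩, ?_⟩
      · simp [update_of_ne (show r ≠ 18 by omega), update_of_ne (show r ≠ 19 by omega), hr r h]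
      · simp only [hm]
        exact fill_succ rfl
      · simpa using hq'

end WordRAM

/-! ### All rounds of the sketch -/

namespace WordRAM

open Function Finset

variable {A n d s w : ℕ} {ω : ℕ → Fin (2 ^ w)} {σ : State}

/-- The projection of the point `i` in round `k`, for points given by `X` as in the memory. -/
def projection (ω : ℕ → Fin (2 ^ w)) (X : ℕ → ℕ) (d s k i : ℕ) : ℕ :=
  ∑ j ∈ range d, (ω (k * (d * s) + (j * s + X (i * d + j))) : ℕ) % 2

/-- The estimate after `m` rounds for the distance of the points `x` and `y`. -/
def estimate (ω : ℕ → Fin (2 ^ w)) (X : ℕ → ℕ) (d s m x y : ℕ) : ℕ :=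
  ∑ k ∈ range m, sqDiff (projection ω X d s k x) (projection ω X d s k y)

theorem projection_le (X : ℕ → ℕ) (k i : ℕ) : projection ω X d s k i ≤ d :=
  (sum_le_card_nsmul _ _ 1 fun _ _ => by omega).trans (by simp)

theorem estimate_le (X : ℕ → ℕ) (m x y : ℕ) : estimate ω X d s m x y ≤ m * (d * d) :=
  (sum_le_card_nsmul _ _ _ fun _ _ => sqDiff_le (projection_le _ _ _) (projection_le _ _ _)).trans
    (by simp)

/-- Each round draws exactly d * s words, so round k reads the tape from position k * (d * s) on.
The input and the estimates survive a round because the bits and projections lie in areas between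
them. -/
theorem runs_sketch (hσ : Layout A n d s w σ.reg) {X : ℕ → ℕ} (hX : ∀ a < n * d, X a < s)
    (hm : ∀ a < n * d, σ.mem a = X a) (hd : σ.drawn = 0)
    (h0 : ∀ q < n * n, σ.mem (σ.reg 7 + q) = 0) :
    Runs w ω sketch σ (fun σ' => (∀ r < 16, σ'.reg r = σ.reg r) ∧
      ∀ x < n, ∀ y < n, σ'.mem (σ.reg 7 + (x * n + y)) = estimate ω X d s (σ.reg 4) x y)
      (σ.reg 4 * (d * s * 16 + 6 + (n * (d * 24 + 21) + 6 + (n * n * 44 + 6)) + 8) + 6) := by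
  have hb := hσ.one_lt
  have h5 := hσ.c5
  have h6 := hσ.c6
  have h7 := hσ.c7
  have h8 := hσ.c8
  have h9 := hσ.c9
  have hn := hσ.one_le_n
  have hlt := hσ.addr_lt
  have hdist := hσ.dist_lt
  refine Runs.mono (.forLt (fun k σ' => (∀ r < 16, σ'.reg r = σ.reg r) ∧
    (∀ a < n * d, σ'.mem a = X a) ∧
    (∀ q < n * n, σ'.mem (σ.reg 7 + q) = estimate ω X d s k (q / n) (q % n)) ∧
    σ'.drawn = k * (d * s)) _ _ hσ.rounds_lt hb ?_ ?_
    ⟨fun _ _ => rfl, hm, by simpa [estimate] using h0, by simpa using hd⟩ ?_) ?_ le_rfl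
  · rintro i σ' v ⟨hr, h⟩
    exact ⟨fun r h => by simp [update_of_ne (show r ≠ 16 by omega), hr r h], h⟩
  · rintro i σ' ⟨hr, -⟩
    exact hr 4 (by norm_num)
  · rintro k hk σ' ⟨hr, hX', hW, hdr⟩ hk'
    have hσ' := hσ.congr hr
    have r5 := hr 5 (by norm_num)
    have r6 := hr 6 (by norm_num)
    have r7 := hr 7 (by norm_num)
    refine .seq (runs_drawBits hσ') ?_
    rintro σ₁ ⟨hr₁, hm₁, hd₁⟩
    have hσ₁ := hσ'.congr fun r h => hr₁ r (by omega)
    have s5 := hr₁ 5 (by norm_num)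
    have s6 := hr₁ 6 (by norm_num)
    have hX₁ : ∀ a < n * d, σ₁.mem a = X a := fun a ha => by
      rw [hm₁, fill_of_lt (by omega), hX' a ha]
    have hbit₁ : ∀ q < d * s, σ₁.mem (σ₁.reg 5 + q) = (ω (k * (d * s) + q) : ℕ) % 2 :=
      fun q hq => by rw [hm₁, s5, fill_add hq, hdr]
    refine .seq (runs_project hσ₁ (fun a ha => by rw [hX₁ a ha]; exact hX a ha)
      fun q hq => by rw [hbit₁ q hq]; omega) ?_
    rintro σ₂ ⟨hr₂, hm₂, hd₂⟩
    have hσ₂ := hσ₁.congr fun r h => hr₂ r (by omega)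
    have u6 := hr₂ 6 (by norm_num)
    have u7 := hr₂ 7 (by norm_num)
    have s7 := hr₁ 7 (by norm_num)
    have hproj : ∀ i < n, σ₂.mem (σ₂.reg 6 + i) = projection ω X d s k i := fun i hi => by
      rw [hm₂, u6, fill_add hi]
      refine sum_congr rfl fun j hj => ?_
      have hij := mul_add_lt hi (mem_range.1 hj)
      rw [hX₁ _ hij, hbit₁ _ (mul_add_lt (mem_range.1 hj) (hX _ hij))]
    have hW₂ : ∀ q < n * n, σ₂.mem (σ₂.reg 7 + q) = estimate ω X d s k (q / n) (q % n) :=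
      fun q hq => by
        rw [hm₂, fill_of_ge (by omega), hm₁, fill_of_ge (by omega), ← hW q hq]
        congr 1
        omega
    refine (runs_accumulate hσ₂ (fun i hi => by rw [hproj i hi]; exact projection_le _ _ _)
      fun q hq => ?_).mono ?_ le_rfl
    -- After k rounds an entry is at most k * (d * d), and k + 1 rounds still fit into a word.
    · rw [hW₂ q hq]
      have h1 := estimate_le (ω := ω) (d := d) (s := s) X k (q / n) (q % n)
      have h2 := Nat.mul_le_mul_right (d * d) (show k + 1 ≤ σ.reg 4 from hk)
      rw [Nat.add_mul, Nat.one_mul] at h2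
      omega
    · rintro σ₃ ⟨hr₃, hm₃, hd₃⟩
      refine ⟨⟨fun r h => ?_, fun a ha => ?_, fun q hq => ?_, ?_⟩, ?_⟩
      · rw [hr₃ r (by omega), hr₂ r (by omega), hr₁ r (by omega), hr r h]
      · rw [hm₃, fill_of_lt (by omega), hm₂, fill_of_lt (by omega), hX₁ a ha]
      · rw [hm₃, show σ.reg 7 = σ₂.reg 7 by omega, fill_add hq, hW₂ q hq,
          hproj _ (Nat.div_lt_of_lt_mul hq), hproj _ (Nat.mod_lt _ hn)]
        exact (sum_range_succ _ _).symm
      · rw [hd₃, hd₂, hd₁, hdr, Nat.add_mul, Nat.one_mul]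
      · rw [hr₃ 16 (by norm_num), hr₂ 16 (by norm_num), hr₁ 16 (by norm_num), hk']
  · rintro σ' ⟨hr, -, hW, -⟩
    refine ⟨hr, fun x hx y hy => ?_⟩
    rw [hW _ (mul_add_lt hx hy), Nat.mul_comm x n, Nat.mul_add_mod, Nat.mod_eq_of_lt hy,
      Nat.mul_add_div hn, Nat.div_eq_of_lt hy, Nat.add_zero]

end WordRAM

/-! ### Prim's algorithm on the machine -/

namespace WordRAM

open Function Finset

variable {A n d s w : ℕ} {ω : ℕ → Fin (2 ^ w)} {σ : State}

/-- The largest word. -/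
def maxWord : Expr := .op .sub (.lit 0) (.lit 1)

theorem eval_maxWord (hw : 1 < 2 ^ w) : maxWord.eval w σ = 2 ^ w - 1 := by
  simp only [maxWord, Expr.eval, Op.eval, Nat.mod_eq_of_lt hw, Nat.zero_mod, Nat.zero_add]
  exact Nat.mod_eq_of_lt (by omega)

/-- Update the key and the parent of the vertex in register `17` with the edge from the vertex in
register `19`. -/
def relax : Program :=
  .ite (.op .lt (.op .add (.load (.op .add (.reg 7) (.op .add (.op .mul (.reg 19) (.reg 0))
      (.reg 17)))) (.lit 1)) (.load (.op .add (.reg 8) (.reg 17))))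
    (.seq (.store (.op .add (.reg 8) (.reg 17)) (.op .add (.load (.op .add (.reg 7)
        (.op .add (.op .mul (.reg 19) (.reg 0)) (.reg 17)))) (.lit 1)))
      (.store (.op .add (.reg 9) (.reg 17)) (.reg 19)))
    .skip

/-- Update the best key and the best vertex with the vertex in register `17`. -/
def improve : Program :=
  .ite (.op .lt (.load (.op .add (.reg 8) (.reg 17))) (.reg 20))
    (.seq (.set 20 (.load (.op .add (.reg 8) (.reg 17)))) (.set 21 (.reg 17)))
    .skip

/-- One step of Prim's algorithm: find the nearest new vertex, and put out the edge to it. -/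
def primStep : Program :=
  .seq (.set 20 maxWord) <| .seq (.set 21 (.lit 0)) <|
  .seq (.forLt 17 0 (.ite (.load (.op .add (.reg 8) (.reg 17))) (.seq relax improve) .skip)) <|
  .seq (.set 19 (.reg 21)) <|
  .seq (.store (.op .mul (.lit 2) (.reg 16)) (.reg 19)) <|
  .seq (.store (.op .add (.op .mul (.lit 2) (.reg 16)) (.lit 1))
    (.load (.op .add (.reg 9) (.reg 19)))) <|
  .store (.op .add (.reg 8) (.reg 19)) (.lit 0)

/-- Prim's algorithm. -/
def prim : Program :=
  .seq (.forLt 17 0 (.store (.op .add (.reg 8) (.reg 17)) maxWord)) <|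
  .seq (.store (.reg 8) (.lit 0)) <| .seq (.set 19 (.lit 0)) <| .forLt 16 11 primStep

/-- The vertices reached by the first `t` edges in the output area. -/
def visited (M : ℕ → ℕ) (t : ℕ) : Finset ℕ := insert 0 ((range t).image fun i => M (2 * i))

theorem visited_succ (M : ℕ → ℕ) (t : ℕ) :
    visited M (t + 1) = insert (M (2 * t)) (visited M t) := by
  rw [visited, visited, range_add_one, image_insert, insert_comm]

theorem card_visited_le (M : ℕ → ℕ) (t : ℕ) : #(visited M t) ≤ t + 1 :=
  (card_insert_le _ _).trans (Nat.add_le_add_right (card_image_le.trans (by simp)) 1)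

theorem visited_congr {M M' : ℕ → ℕ} {t : ℕ} (h : ∀ i < t, M (2 * i) = M' (2 * i)) :
    visited M t = visited M' t := by
  rw [visited, visited, image_congr fun i hi => h i (mem_range.1 hi)]

/-- The first `T` edges in the output area are those of a run of Prim's algorithm for the
weights `W` on the vertices `0, …, n - 1`. -/
def PrimTrace (n : ℕ) (W : ℕ → ℕ → ℕ) (M : ℕ → ℕ) (T : ℕ) : Prop :=
  ∀ t < T, M (2 * t) < n ∧ M (2 * t) ∉ visited M t ∧ M (2 * t + 1) ∈ visited M t ∧
    ∀ x ∈ visited M t, ∀ y < n, y ∉ visited M t → W (M (2 * t + 1)) (M (2 * t)) ≤ W x y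

theorem PrimTrace.congr {W : ℕ → ℕ → ℕ} {M M' : ℕ → ℕ} {T : ℕ} (h : PrimTrace n W M T)
    (hM : ∀ a < 2 * T, M' a = M a) : PrimTrace n W M' T := by
  intro t ht
  rw [visited_congr fun i hi => hM (2 * i) (by omega), hM _ (by omega), hM _ (by omega)]
  exact h t ht

theorem PrimTrace.visited_lt {W : ℕ → ℕ → ℕ} {M : ℕ → ℕ} {T x : ℕ} (h : PrimTrace n W M T)
    (hn : 1 ≤ n) (hx : x ∈ visited M T) : x < n := by
  simp only [visited, mem_insert, mem_image, mem_range] at hx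
  obtain rfl | ⟨i, hi, rfl⟩ := hx
  · omega
  · exact (h i hi).1

/-- The key and the parent of the vertex `u` describe a shortest edge from `S` to `u`. -/
def KeyOK (w : ℕ) (W : ℕ → ℕ → ℕ) (S : Finset ℕ) (key par : ℕ → ℕ) (u : ℕ) : Prop :=
  key u ≠ 0 ∧ key u < 2 ^ w ∧ (∀ x ∈ S, key u ≤ W x u + 1) ∧
    (key u < 2 ^ w - 1 → par u ∈ S ∧ key u = W (par u) u + 1)

/-- Keys hold the weight plus 1: the value 0 is reserved for visited vertices and the largest word
for vertices without a known edge. Hence the bound `hlt` on the weights. -/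
theorem runs_relax (hσ : Layout A n d s w σ.reg) {u v : ℕ} (hu : u < n) (hv : v < n)
    (h17 : σ.reg 17 = u) (h19 : σ.reg 19 = v) {W : ℕ → ℕ → ℕ}
    (hW : σ.mem (σ.reg 7 + (v * n + u)) = W v u) (hlt : W v u + 1 < 2 ^ w - 1) :
    Runs w ω relax σ (fun σ' => σ'.reg = σ.reg ∧ σ'.drawn = σ.drawn ∧
      σ'.mem = if W v u + 1 < σ.mem (σ.reg 8 + u) then
        update (update σ.mem (σ.reg 8 + u) (W v u + 1)) (σ.reg 9 + u) v else σ.mem) 35 := by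
  have hb := hσ.one_lt
  have h7 := hσ.c7
  have h8 := hσ.c8
  have h9 := hσ.c9
  have haddr := hσ.addr_lt
  have hvu := mul_add_lt hv hu
  have e8 : (Expr.op .add (.reg 8) (.reg 17)).eval w σ = σ.reg 8 + u :=
    Expr.eval_add rfl h17 (by omega)
  have eW : (Expr.op .add (.load (.op .add (.reg 7) (.op .add (.op .mul (.reg 19) (.reg 0))
      (.reg 17)))) (.lit 1)).eval w σ = W v u + 1 := by
    refine Expr.eval_add ?_ (Expr.eval_lit hb) (by omega)
    rw [Expr.eval_load (Expr.eval_add (a := σ.reg 7) rfl (Expr.eval_add (Expr.eval_mul (Expr.eval_reg h19)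
      (Expr.eval_reg hσ.c0) (by omega)) (Expr.eval_reg h17) (by omega)) (by omega)), hW]
  have hif := Expr.eval_lt_ne_zero eW (Expr.eval_load e8) hb
  refine Runs.mono (T := 15 + 1 + 19) (.ite (fun h => ?_) fun h => ?_) (fun _ h => h) (by omega)
  · refine Runs.mono (T := 14 + 5) (.seq (.store e8 eW rfl) ?_) (fun _ h => h) (by omega)
    rintro _ rfl
    refine .store (a := σ.reg 9 + u) (Expr.eval_add rfl h17 (by omega)) (Expr.eval_reg h19) ?_
    exact ⟨rfl, rfl, by rw [if_pos (hif.1 h)]⟩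
  · refine (Runs.skip ?_).mono (fun _ h => h) (by omega)
    exact ⟨rfl, rfl, by rw [if_neg fun h' => hif.2 h' h]⟩

theorem runs_improve (hσ : Layout A n d s w σ.reg) {u : ℕ} (hu : u < n) (h17 : σ.reg 17 = u) :
    Runs w ω improve σ (fun σ' => σ'.mem = σ.mem ∧
      (∀ r < 20, σ'.reg r = σ.reg r) ∧
      if σ.mem (σ.reg 8 + u) < σ.reg 20 then
        σ'.reg 20 = σ.mem (σ.reg 8 + u) ∧ σ'.reg 21 = u
      else σ'.reg 20 = σ.reg 20 ∧ σ'.reg 21 = σ.reg 21) 14 := by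
  have hb := hσ.one_lt
  have h9 := hσ.c9
  have haddr := hσ.addr_lt
  have e8 : (Expr.op .add (.reg 8) (.reg 17)).eval w σ = σ.reg 8 + u :=
    Expr.eval_add rfl h17 (by omega)
  have hif := Expr.eval_lt_ne_zero (Expr.eval_load e8) (Expr.eval_reg (r := 20) rfl) hb
  refine Runs.mono (T := 6 + 1 + 7) (.ite (fun h => ?_) fun h => ?_) (fun _ h => h) (by omega)
  · refine .seq (T₁ := 5) (T₂ := 2) (.set (Expr.eval_load e8) rfl) ?_
    rintro _ rfl
    refine .set (v := u) (by simpa [Expr.eval] using h17) ?_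
    refine ⟨rfl, fun r hr => ?_, ?_⟩
    · simp [update_of_ne (show r ≠ 20 by omega), update_of_ne (show r ≠ 21 by omega)]
    · rw [if_pos (hif.1 h)]
      simp
  · refine (Runs.skip ?_).mono (fun _ h => h) (by omega)
    refine ⟨rfl, fun _ _ => rfl, ?_⟩
    rw [if_neg fun h' => hif.2 h' h]
    exact ⟨rfl, rfl⟩

/-- The invariant of the search for the nearest new vertex: the vertices below `j` are done. -/
structure Search (n w : ℕ) (W : ℕ → ℕ → ℕ) (S : Finset ℕ) (σ₀ : State) (j : ℕ) (σ : State) :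
    Prop where
  reg : ∀ r < 17, σ.reg r = σ₀.reg r
  cur : σ.reg 19 = σ₀.reg 19
  mem : ∀ a < σ₀.reg 8, σ.mem a = σ₀.mem a
  key_visited : ∀ u ∈ S, u < n → σ.mem (σ₀.reg 8 + u) = 0
  key : ∀ u < n, u ∉ S → KeyOK w W (if u < j then S else S.erase (σ₀.reg 19))
    (fun u => σ.mem (σ₀.reg 8 + u)) (fun u => σ.mem (σ₀.reg 9 + u)) u
  best_le : ∀ u < j, u ∉ S → σ.reg 20 ≤ σ.mem (σ₀.reg 8 + u)
  best : σ.reg 20 < 2 ^ w - 1 →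
    σ.reg 21 < j ∧ σ.reg 21 ∉ S ∧ σ.mem (σ₀.reg 8 + σ.reg 21) = σ.reg 20

theorem Search.update_reg {W : ℕ → ℕ → ℕ} {S : Finset ℕ} {σ₀ : State} {j : ℕ}
    (h : Search n w W S σ₀ j σ) (v : ℕ) :
    Search n w W S σ₀ j { σ with reg := update σ.reg 17 v } :=
  ⟨fun r hr => by simp [update_of_ne (show r ≠ 17 by omega), h.reg r hr], by simpa using h.cur,
    h.mem, h.key_visited, h.key, by simpa using h.best_le, by simpa using h.best⟩

/-- Relaxation with the edges of the latest vertex (register 19) and the search for the minimum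
share one pass. Keys of vertices below j therefore account for all of S, the others only for S
without the latest vertex. -/
theorem runs_searchStep {W : ℕ → ℕ → ℕ} {S : Finset ℕ} {σ₀ : State} {j : ℕ}
    (hσ₀ : Layout A n d s w σ₀.reg) (hcur : σ₀.reg 19 ∈ S) (hcur_lt : σ₀.reg 19 < n)
    (hW : ∀ x < n, ∀ y < n, σ₀.mem (σ₀.reg 7 + (x * n + y)) = W x y)
    (hWlt : ∀ x < n, ∀ y < n, W x y + 1 < 2 ^ w - 1)
    (h : Search n w W S σ₀ j σ) (hj : j < n) (h17 : σ.reg 17 = j) :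
    Runs w ω (.ite (.load (.op .add (.reg 8) (.reg 17))) (.seq relax improve) .skip) σ
      (fun σ' => Search n w W S σ₀ (j + 1) σ' ∧ σ'.reg 17 = j) 54 := by
  have hb := hσ₀.one_lt
  have h7 := hσ₀.c7
  have h8 := hσ₀.c8
  have h9 := hσ₀.c9
  have haddr := hσ₀.addr_lt
  have hσ := hσ₀.congr fun r hr => h.reg r (by omega)
  have r7 := h.reg 7 (by norm_num)
  have r8 := h.reg 8 (by norm_num)
  have r9 := h.reg 9 (by norm_num)
  have e8 : (Expr.op .add (.reg 8) (.reg 17)).eval w σ = σ₀.reg 8 + j :=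
    Expr.eval_add r8 h17 (by omega)
  set v := σ₀.reg 19 with hv
  have hvj := mul_add_lt hcur_lt hj
  refine Runs.mono (T := 4 + 1 + (35 + 14)) (.ite (fun he => ?_) fun he => ?_) (fun _ h => h)
    (by omega)
  · rw [Expr.eval_load e8] at he
    have hjS : j ∉ S := fun hjS => he (h.key_visited j hjS hj)
    refine .seq (runs_relax hσ (W := W) hj hcur_lt h17 h.cur
      (by rw [h.mem _ (by omega), r7, hW _ hcur_lt _ hj]) (hWlt _ hcur_lt _ hj)) ?_
    rintro σ₁ ⟨hr₁, -, hm₁⟩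
    refine (runs_improve (by rwa [hr₁]) hj (by rwa [hr₁])).mono ?_ le_rfl
    rintro σ₂ ⟨hm₂, hr₂, hif⟩
    rw [hr₁] at hr₂ hif
    rw [r8, r9] at hm₁
    rw [r8, ← hm₂] at hif
    rw [← hm₂] at hm₁
    have hold := h.key j hj hjS
    -- The vertex j has not yet been relaxed in this pass, so its key ignores the latest vertex.
    rw [if_neg (lt_irrefl j)] at hold
    have hother : ∀ a, a ≠ σ₀.reg 8 + j → a ≠ σ₀.reg 9 + j → σ₂.mem a = σ.mem a := by
      intro a h1 h2
      rw [hm₁]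
      split_ifs
      · rw [update_of_ne h2, update_of_ne h1]
      · rfl
    have hnew : KeyOK w W S (fun u => σ₂.mem (σ₀.reg 8 + u)) (fun u => σ₂.mem (σ₀.reg 9 + u)) j := by
      obtain ⟨k1, k2, k3, k4⟩ := hold
      have hWj := hWlt _ hcur_lt _ hj
      by_cases hc : W v j + 1 < σ.mem (σ₀.reg 8 + j)
      · have m8 : σ₂.mem (σ₀.reg 8 + j) = W v j + 1 := by
          rw [hm₁, if_pos hc, update_of_ne (by omega), update_self]
        have m9 : σ₂.mem (σ₀.reg 9 + j) = v := by rw [hm₁, if_pos hc, update_self]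
        simp only [KeyOK, m8, m9]
        refine ⟨by omega, by omega, fun x hx => ?_, fun _ => ⟨hcur, trivial⟩⟩
        by_cases hxv : x = v
        · rw [hxv]
        · exact hc.le.trans (k3 x (mem_erase.2 ⟨hxv, hx⟩))
      · rw [if_neg hc] at hm₁
        simp only [KeyOK, hm₁]
        refine ⟨k1, k2, fun x hx => ?_, fun hlt => ⟨mem_of_mem_erase (k4 hlt).1, (k4 hlt).2⟩⟩
        by_cases hxv : x = v
        · rw [hxv]
          omega
        · exact k3 x (mem_erase.2 ⟨hxv, hx⟩)
    refine ⟨⟨fun r hr => ?_, ?_, fun a ha => ?_, fun u hu hun => ?_, fun u hun hu => ?_,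
      fun u huj hu => ?_, fun hlt => ?_⟩, ?_⟩
    · rw [hr₂ r (by omega), h.reg r hr]
    · rw [hr₂ 19 (by norm_num), h.cur]
    · rw [hother a (by omega) (by omega), h.mem a ha]
    · have huj : u ≠ j := fun e => hjS (e ▸ hu)
      rw [hother _ (by omega) (by omega), h.key_visited u hu hun]
    · by_cases huj : u = j
      · rw [huj, if_pos (Nat.lt_succ_self j)]
        exact hnew
      · have hk := h.key u hun hu
        simp only [KeyOK] at hk ⊢
        rw [hother (σ₀.reg 8 + u) (by omega) (by omega), hother (σ₀.reg 9 + u) (by omega) (by omega)]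
        simp only [show u < j + 1 ↔ u < j by omega]
        exact hk
    · by_cases huj' : u = j
      · rw [huj']
        split_ifs at hif <;> omega
      · have := h.best_le u (by omega) hu
        rw [← hother (σ₀.reg 8 + u) (by omega) (by omega)] at this
        split_ifs at hif <;> omega
    · split_ifs at hif with hc
      · rw [hif.2, hif.1]
        exact ⟨Nat.lt_succ_self j, hjS, rfl⟩
      · rw [hif.1] at hlt
        obtain ⟨b1, b2, b3⟩ := h.best hlt
        rw [hif.2, hif.1]
        exact ⟨by omega, b2, by rw [hother _ (by omega) (by omega), b3]⟩
    · rw [hr₂ 17 (by norm_num), h17]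
  · rw [Expr.eval_load e8] at he
    refine (Runs.skip ⟨?_, h17⟩).mono (fun _ h => h) (by omega)
    have hjS : j ∈ S := by
      by_contra hjS
      exact (h.key j hj hjS).1 he
    refine { h with key := fun u hun hu => ?_, best_le := fun u huj hu => ?_, best := fun hlt => ?_ }
    · have huj : u ≠ j := fun e => hu (e ▸ hjS)
      simp only [show u < j + 1 ↔ u < j by omega]
      exact h.key u hun hu
    · have huj' : u ≠ j := fun e => hu (e ▸ hjS)
      exact h.best_le u (by omega) hu
    · obtain ⟨b1, b2, b3⟩ := h.best hlt
      exact ⟨by omega, b2, b3⟩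

/-- The invariant of Prim's algorithm after `t` steps. -/
structure PrimInv (n w : ℕ) (W : ℕ → ℕ → ℕ) (c : ℕ → ℕ) (t : ℕ) (σ : State) : Prop where
  reg : ∀ r < 16, σ.reg r = c r
  weight : ∀ x < n, ∀ y < n, σ.mem (c 7 + (x * n + y)) = W x y
  trace : PrimTrace n W σ.mem t
  cur : σ.reg 19 ∈ visited σ.mem t
  key_visited : ∀ u ∈ visited σ.mem t, u < n → σ.mem (c 8 + u) = 0
  key : ∀ u < n, u ∉ visited σ.mem t → KeyOK w W ((visited σ.mem t).erase (σ.reg 19))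
    (fun u => σ.mem (c 8 + u)) (fun u => σ.mem (c 9 + u)) u

/-- After the pass every key of an unvisited vertex is 1 plus its least distance to S. The vertex
with the least key, together with its parent, is then a lightest edge across the cut. -/
theorem runs_primStep {W : ℕ → ℕ → ℕ} {c : ℕ → ℕ} {t : ℕ} (hc : Layout A n d s w c)
    (hWlt : ∀ x < n, ∀ y < n, W x y + 1 < 2 ^ w - 1) (h : PrimInv n w W c t σ) (ht : t < n - 1)
    (h16 : σ.reg 16 = t) :
    Runs w ω primStep σ (fun σ' => PrimInv n w W c (t + 1) σ' ∧ σ'.reg 16 = t)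
      (n * 62 + 40) := by
  have hb := hc.one_lt
  have h5 := hc.c5
  have h6 := hc.c6
  have h7 := hc.c7
  have h8 := hc.c8
  have h9 := hc.c9
  have hn := hc.one_le_n
  have haddr := hc.addr_lt
  have hσ := hc.congr h.reg
  have r7 := h.reg 7 (by norm_num)
  have r8 := h.reg 8 (by norm_num)
  have r9 := h.reg 9 (by norm_num)
  set S := visited σ.mem t with hS
  have hcur_lt := h.trace.visited_lt hn h.cur
  refine Runs.mono (T := 4 + (2 + ((n * (54 + 8) + 6) + (2 + (5 + (10 + 5)))))) ?_ (fun _ h => h)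
    (by omega)
  refine .seq (.set (eval_maxWord hb) rfl) ?_
  rintro _ rfl
  refine .seq (.set (v := 0) (Expr.eval_lit (by omega)) rfl) ?_
  rintro _ rfl
  refine .seq (.forLt (Search n w W S σ) n 54 (by omega) hb (fun j τ v hτ => hτ.update_reg v)
    (fun j τ hτ => by rw [hτ.reg 0 (by norm_num), h.reg 0 (by norm_num), hc.c0]) ?_
    (fun j hj τ hτ hj' => runs_searchStep hσ h.cur hcur_lt (by rw [r7]; exact h.weight) hWlt hτ
      hj hj')) ?_
  · refine ⟨fun r hr => ?_, by simp, fun _ _ => rfl, ?_, ?_, by simp, by simp⟩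
    · simp [update_of_ne (show r ≠ 20 by omega), update_of_ne (show r ≠ 21 by omega)]
    · rw [r8]
      exact h.key_visited
    · rw [r8, r9]
      simpa using h.key
  rintro τ hτ
  have t8 : τ.reg 8 = c 8 := (hτ.reg 8 (by norm_num)).trans r8
  have t9 : τ.reg 9 = c 9 := (hτ.reg 9 (by norm_num)).trans r9
  have t16 : τ.reg 16 = t := (hτ.reg 16 (by norm_num)).trans h16
  have hkey := hτ.key
  have hkeyv := hτ.key_visited
  have hbest_le := hτ.best_le
  have hbest := hτ.best
  have hmem := hτ.mem
  rw [r8] at hkey hkeyv hbest_le hbest hmem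
  rw [r9] at hkey
  -- At most t + 1 < n vertices are visited, so a new vertex with a finite key exists and the search
  -- does not come back empty.
  obtain ⟨y, hyn, hyS⟩ : ∃ y ∈ range n, y ∉ S := by
    by_contra! hall
    have := (card_le_card hall).trans (card_visited_le _ _)
    rw [card_range] at this
    omega
  rw [mem_range] at hyn
  have hlt : τ.reg 20 < 2 ^ w - 1 := by
    have h1 := hbest_le y hyn hyS
    have h2 := (hkey y hyn hyS).2.2.1 (σ.reg 19) (by rw [if_pos hyn]; exact h.cur)
    have h3 := hWlt _ hcur_lt y hyn
    dsimp only at h2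
    omega
  obtain ⟨hvn, hvS, hvkey⟩ := hbest hlt
  set v := τ.reg 21 with hv
  obtain ⟨-, -, -, hv4⟩ := hkey v hvn hvS
  rw [if_pos hvn] at hv4
  dsimp only at hv4
  rw [hvkey] at hv4
  obtain ⟨hpar, hpar'⟩ := hv4 hlt
  set p := τ.mem (c 9 + v) with hp
  refine .seq (.set (v := v) rfl rfl) ?_
  rintro _ rfl
  refine .seq (.store (a := 2 * t) (v := v) (Expr.eval_mul (Expr.eval_lit (by omega))
    (by simpa [Expr.eval] using t16) (by omega)) (by simp [Expr.eval]) rfl) ?_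
  rintro _ rfl
  refine .seq (.store (a := 2 * t + 1) (v := p) (Expr.eval_add (Expr.eval_mul
    (Expr.eval_lit (by omega)) (by simpa [Expr.eval] using t16) (by omega))
    (Expr.eval_lit (by omega)) (by omega)) ?_ rfl) ?_
  · rw [Expr.eval_load (Expr.eval_add (a := c 9) (b := v) (by simpa [Expr.eval] using t9)
      (by simp [Expr.eval]) (by omega))]
    exact update_of_ne (by omega) _ _
  rintro _ rfl
  refine .store (a := c 8 + v) (v := 0) (Expr.eval_add (by simpa [Expr.eval] using t8)
    (by simp [Expr.eval]) (by omega)) (Expr.eval_lit (by omega)) ?_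
  set M := update (update (update τ.mem (2 * t) v) (2 * t + 1) p) (c 8 + v) 0 with hM
  have hlow : ∀ a < 2 * t, M a = σ.mem a := fun a ha => by
    rw [hM, update_of_ne (by omega), update_of_ne (by omega), update_of_ne (by omega),
      hmem _ (by omega)]
  have hMv : M (2 * t) = v := by
    rw [hM, update_of_ne (by omega), update_of_ne (by omega), update_self]
  have hMp : M (2 * t + 1) = p := by rw [hM, update_of_ne (by omega), update_self]
  -- The output cells 2t and 2t + 1 lie below 2n, hence below all work areas.
  have hhigh : ∀ a, c 5 ≤ a → a ≠ c 8 + v → M a = τ.mem a := fun a ha hne => by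
    rw [hM, update_of_ne hne, update_of_ne (by omega), update_of_ne (by omega)]
  have hvis : visited M t = S := visited_congr fun i hi => hlow _ (by omega)
  have hvis' : visited M (t + 1) = insert v S := by rw [visited_succ, hvis, hMv]
  refine ⟨⟨fun r hr => ?_, fun x hx y hy => ?_, fun i hi => ?_, ?_, fun u hu hun => ?_,
    fun u hun hu => ?_⟩, ?_⟩
  · simp [update_of_ne (show r ≠ 19 by omega), hτ.reg r (by omega), h.reg r hr]
  · have := mul_add_lt hx hy
    refine (hhigh _ (by omega) (by omega)).trans ?_
    rw [hmem _ (by omega), h.weight x hx y hy]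
  · obtain hi | rfl := Nat.lt_succ_iff_lt_or_eq.1 hi
    · exact h.trace.congr hlow i hi
    · dsimp only
      rw [hvis, hMv, hMp]
      refine ⟨hvn, hvS, hpar, fun x hx z hz hzS => ?_⟩
      have h1 := hbest_le z hz hzS
      have h2 := (hkey z hz hzS).2.2.1 x (by rwa [if_pos hz])
      dsimp only at h2
      omega
  · dsimp only
    rw [hvis']
    simp
  · dsimp only at hu ⊢
    rw [hvis', mem_insert] at hu
    by_cases huv : u = v
    · rw [huv, hM, update_self]
    · rw [hhigh _ (by omega) (by omega), hkeyv u (hu.resolve_left huv) hun]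
  · dsimp only at hu ⊢
    rw [hvis', mem_insert, not_or] at hu
    have hk := hkey u hun hu.2
    rw [if_pos hun] at hk
    rw [hvis']
    -- The new vertex becomes the latest one; erasing it from the enlarged set gives back S, for
    -- which the keys are already correct.
    simp only [KeyOK, update_self, erase_insert hvS] at hk ⊢
    rw [hhigh (c 8 + u) (by omega) (by omega), hhigh (c 9 + u) (by omega) (by omega)]
    exact hk
  · simpa using t16

theorem runs_prim {W : ℕ → ℕ → ℕ} (hσ : Layout A n d s w σ.reg)
    (hW : ∀ x < n, ∀ y < n, σ.mem (σ.reg 7 + (x * n + y)) = W x y)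
    (hWlt : ∀ x < n, ∀ y < n, W x y + 1 < 2 ^ w - 1) :
    Runs w ω prim σ (fun σ' => PrimTrace n W σ'.mem (n - 1)) (n * (n * 62 + 65) + 20) := by
  have hb := hσ.one_lt
  have h7 := hσ.c7
  have h8 := hσ.c8
  have h9 := hσ.c9
  have hn := hσ.one_le_n
  have haddr := hσ.addr_lt
  refine Runs.mono (T := n * (7 + 8) + 6 + (3 + (2 + ((n - 1) * (n * 62 + 40 + 8) + 6)))) (.seq
    (.forLt (fun i σ' => (∀ r < 16, σ'.reg r = σ.reg r) ∧
      σ'.mem = fill σ.mem (σ.reg 8) i (fun _ => 2 ^ w - 1)) n 7 (by omega) hb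
      ?_ ?_ ⟨fun _ _ => rfl, fill_zero.symm⟩ ?_) ?_) (fun _ h => h) ?_
  · rintro i σ' v ⟨hr, hm⟩
    exact ⟨fun r h => by simp [update_of_ne (show r ≠ 17 by omega), hr r h], hm⟩
  · rintro i σ' ⟨hr, -⟩
    rw [hr 0 (by norm_num), hσ.c0]
  · rintro i hi σ' ⟨hr, hm⟩ hi'
    refine .store (a := σ.reg 8 + i) (Expr.eval_add (hr 8 (by norm_num)) hi' (by omega))
      (eval_maxWord hb) ⟨⟨hr, ?_⟩, hi'⟩
    simp only [hm]
    exact fill_succ rfl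
  · rintro τ ⟨hr, hm⟩
    refine .seq (.store (a := σ.reg 8) (v := 0) (hr 8 (by norm_num)) (Expr.eval_lit (by omega))
      rfl) ?_
    rintro _ rfl
    refine .seq (.set (v := 0) (Expr.eval_lit (by omega)) rfl) ?_
    rintro _ rfl
    refine (Runs.forLt (PrimInv n w W σ.reg) (n - 1) (n * 62 + 40) (by omega) hb ?_ ?_ ?_
      fun t ht σ' h h16 => runs_primStep hσ hWlt h ht h16).mono (fun _ h => h.trace) le_rfl
    · rintro t σ' v h
      exact ⟨fun r hr => by simp [update_of_ne (show r ≠ 16 by omega), h.reg r hr], h.weight,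
        h.trace, by simpa using h.cur, h.key_visited, by simpa using h.key⟩
    · rintro t σ' h
      rw [h.reg 11 (by norm_num), hσ.c11]
    -- At the start only vertex 0 is visited and it is also the latest one, so the infinite keys
    -- need to respect no edge at all.
    · refine ⟨fun r hr' => by simp [update_of_ne (show r ≠ 19 by omega), hr r hr'],
        fun x hx y hy => ?_, fun t ht => absurd ht (by omega), by simp [visited], ?_, ?_⟩
      · have := mul_add_lt hx hy
        simp only
        rw [update_of_ne (by omega), hm, fill_of_lt (by omega), hW x hx y hy]
      · simp [visited]
      · intro u hun hu
        simp only [visited, range_zero, image_empty, mem_insert, notMem_empty, or_false] at hu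
        simp only [KeyOK]
        rw [update_of_ne (by omega), hm, fill_add hun]
        simp [visited]
        omega
  · have := Nat.mul_le_mul_right (n * 62 + 40 + 8) (show n - 1 ≤ n by omega)
    simp only [Nat.mul_add] at this ⊢
    omega

end WordRAM

/-! ### The whole program -/

namespace WordRAM

open Function Finset

variable {A n d s w : ℕ} {ω : ℕ → Fin (2 ^ w)} {σ : State}

/-- Estimate all distances by a random sketch, then compute a minimum spanning tree for the
estimates. -/
def sketchMST (A : ℕ) : Program := .seq (setup A) (.seq sketch prim)

theorem sqDiff_comm (a b : ℕ) : sqDiff a b = sqDiff b a := by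
  rw [sqDiff, sqDiff, Nat.mul_comm b a, Nat.add_comm]

theorem estimate_comm (X : ℕ → ℕ) (m x y : ℕ) :
    estimate ω X d s m x y = estimate ω X d s m y x :=
  sum_congr rfl fun _ _ => sqDiff_comm _ _

/-- Valid for every tape: the quality of the estimates plays no role for the run. The estimate
matrix needs no initialization because memory beyond the input is zero. -/
theorem runs_sketchMST (hn : 1 ≤ n) (hd : 1 ≤ d) (hs : 1 ≤ s) (hA : 1 ≤ A)
    (hw : (A + 20) * (n * d * s) ^ 3 ≤ 2 ^ w) (h0 : σ.reg 0 = n) (h1 : σ.reg 1 = d)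
    (h2 : σ.reg 2 = s) (hdr : σ.drawn = 0) (hX : ∀ a < n * d, σ.mem a < s)
    (hzero : ∀ a, n * d ≤ a → σ.mem a = 0) :
    Runs w ω (sketchMST A) σ (fun σ' => PrimTrace n
      (estimate ω σ.mem d s (A * (Nat.log 2 (n * d) + 1))) σ'.mem (n - 1))
      (300 * (A * (Nat.log 2 (n * d) + 1)) * (d * s + n * d + n * n)) := by
  refine Runs.mono (.seq (runs_setup hn hd hs hA hw h0 h1 h2) ?_) (fun _ h => h)
    (T := (Nat.log 2 (n * d) + 1) * 10 + 50 +
      (A * (Nat.log 2 (n * d) + 1) * (d * s * 16 + 6 + (n * (d * 24 + 21) + 6 +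
        (n * n * 44 + 6)) + 8) + 6 + (n * (n * 62 + 65) + 20))) ?_
  · rintro τ ⟨hτ, hm, hdr'⟩
    have h7 : n * d ≤ τ.reg 7 := by
      rw [hτ.c7, hτ.c6, hτ.c5]
      omega
    rw [← hτ.c4]
    refine .seq (runs_sketch hτ hX (fun a _ => by rw [hm]) (hdr'.trans hdr) fun q _ => by
      rw [hm, hzero _ (by omega)]) ?_
    rintro τ' ⟨hr, hW⟩
    have hdist := hτ.dist_lt
    refine runs_prim (hτ.congr hr) (by rw [hr 7 (by norm_num)]; exact hW) fun x _ y _ => ?_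
    have := estimate_le (ω := ω) (d := d) (s := s) σ.mem (τ.reg 4) x y
    omega
  · set l := Nat.log 2 (n * d) + 1 with hl
    have hl1 : 1 ≤ l := by omega
    have hAl : l ≤ A * l := Nat.le_mul_of_pos_left _ hA
    set m := A * l
    have hnd : n ≤ n * d := Nat.le_mul_of_pos_right _ hd
    have hnn : n ≤ n * n := Nat.le_mul_of_pos_right _ hn
    have hE : d * s * 16 + 6 + (n * (d * 24 + 21) + 6 + (n * n * 44 + 6)) + 8 ≤
        100 * (d * s + n * d + n * n) := by
      have : 1 ≤ d * s := Nat.mul_pos hd hs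
      have e1 : n * (d * 24 + 21) = 24 * (n * d) + 21 * n := by ring
      omega
    have hF : 86 + n * (n * 62 + 65) ≤ 190 * (d * s + n * d + n * n) := by
      have : 1 ≤ d * s := Nat.mul_pos hd hs
      have e1 : n * (n * 62 + 65) = 62 * (n * n) + 65 * n := by ring
      omega
    have hE' := Nat.mul_le_mul_left m hE
    set B := d * s + n * d + n * n with hB
    have hB1 : 1 ≤ B := by omega
    have hmB : m ≤ m * B := Nat.le_mul_of_pos_right _ hB1
    have hBm : B ≤ m * B := Nat.le_mul_of_pos_left _ (by omega)
    have e1 : m * (100 * B) = 100 * (m * B) := by ring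
    have e2 : 300 * m * B = 300 * (m * B) := by ring
    omega

end WordRAM

/-! ### Optimality of Prim's tree and the distortion bound -/

namespace HammingMST

open Finset WordRAM

section Cut

variable {V : Type*}

/-- The edges in `F` connect every vertex to the set `S`. -/
def Spans (S : Set V) (F : Finset (Sym2 V)) : Prop :=
  ∀ U : Set V, S ⊆ U → U ≠ Set.univ → ∃ x ∈ U, ∃ y ∉ U, s(x, y) ∈ F

/-- F contains an edge e from S to the part of V \ S that F connects to v. Once v joins S, that part
is attached through v and e is superfluous. Stating this with cuts avoids any reasoning about
cycles. -/
theorem Spans.exchange [DecidableEq V] {S : Set V} {F : Finset (Sym2 V)} (h : Spans S F) {v : V} (hv : v ∉ S)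
    {wt : Sym2 V → ℕ} {c : ℕ} (hc : ∀ x ∈ S, ∀ y ∉ S, c ≤ wt s(x, y)) :
    ∃ e ∈ F, c ≤ wt e ∧ Spans (insert v S) (F.erase e) := by
  -- The vertices reachable from v along F-edges without entering S.
  let R : Set V := {y | Relation.ReflTransGen (fun a b => b ∉ S ∧ s(a, b) ∈ F) v y}
  have hRS : ∀ y ∈ R, y ∉ S := by
    intro y hy
    obtain rfl | ⟨_, -, h⟩ := Relation.ReflTransGen.cases_tail hy
    · exact hv
    · exact h.1
  have hvR : v ∈ R := Relation.ReflTransGen.refl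
  obtain ⟨x, hx, y, hy, hxy⟩ := h Rᶜ (fun z hz hzR => hRS z hzR hz)
    (fun hU => by
      have : v ∈ Rᶜ := hU ▸ Set.mem_univ v
      exact this hvR)
  rw [Set.notMem_compl_iff] at hy
  -- Otherwise the path to y could be prolonged to x, putting x into R.
  have hxS : x ∈ S := by
    by_contra hxS
    exact hx (Relation.ReflTransGen.tail hy ⟨hxS, by rwa [Sym2.eq_swap]⟩)
  refine ⟨s(x, y), hxy, hc x hxS y (hRS y hy), fun U hSU hU => ?_⟩
  obtain ⟨a, ha, b, hb, hab⟩ := h U ((Set.subset_insert v S).trans hSU) hU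
  by_cases he : s(a, b) = s(x, y)
  · have hyU : y ∉ U := by
      rcases Sym2.eq_iff.1 he with ⟨rfl, rfl⟩ | ⟨rfl, rfl⟩
      · exact hb
      · exact absurd (hSU (Set.mem_insert_of_mem _ hxS)) hb
    have hvU : v ∈ U := hSU (Set.mem_insert v S)
    by_contra! hno
    refine hyU ?_
    clear hb hab he hyU hx
    -- The path from v to y avoids S and so never uses e, which has an end in S. If no other F-edge
    -- leaves U, the path stays in U, contradicting y ∉ U.
    have key : ∀ z, Relation.ReflTransGen (fun a b => b ∉ S ∧ s(a, b) ∈ F) v z → z ∈ U := by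
      intro z hz
      induction hz with
      | refl => exact hvU
      | @tail p q hp hq ih =>
        by_contra hqU
        refine hno p ih q hqU (mem_erase.2 ⟨fun e => ?_, hq.2⟩)
        rcases Sym2.eq_iff.1 e with ⟨rfl, rfl⟩ | ⟨rfl, rfl⟩
        · exact hRS _ hp hxS
        · exact hqU (hSU (Set.mem_insert_of_mem _ hxS))
    exact key y hy
  · exact ⟨a, ha, b, hb, mem_erase.2 ⟨he, hab⟩⟩

theorem spans_edgeFinset {H : SimpleGraph V} [Fintype H.edgeSet] (hH : H.Connected) (v : V) :
    Spans {v} H.edgeFinset := by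
  intro U hU hne
  obtain ⟨y, hy⟩ := (Set.ne_univ_iff_exists_notMem U).1 hne
  obtain ⟨p⟩ := hH.preconnected v y
  obtain ⟨e, -, he, he'⟩ := p.exists_boundary_dart U (hU rfl) hy
  exact ⟨_, he, _, he', SimpleGraph.mem_edgeFinset.2 e.adj⟩

end Cut

variable {n d s : ℕ} {W : ℕ → ℕ → ℕ} {M : ℕ → ℕ} {σ : State}

/-- The edge of the step `t` in the output area. -/
def outEdge (n : ℕ) [NeZero n] (M : ℕ → ℕ) (t : ℕ) : Sym2 (Fin n) :=
  s(Fin.ofNat n (M (2 * t)), Fin.ofNat n (M (2 * t + 1)))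

/-- The vertices reached by the first `t` edges. -/
def reached (n : ℕ) (M : ℕ → ℕ) (t : ℕ) : Set (Fin n) := {x | (x : ℕ) ∈ visited M t}

theorem card_visited {T t : ℕ} (h : PrimTrace n W M T) (ht : t ≤ T) : #(visited M t) = t + 1 := by
  induction t with
  | zero => simp [visited]
  | succ t ih => rw [visited_succ, card_insert_of_notMem (h t ht).2.1, ih (by omega)]

theorem reached_eq_univ (hn : 1 ≤ n) (h : PrimTrace n W M (n - 1)) :
    reached n M (n - 1) = Set.univ := by
  have hsub : visited M (n - 1) ⊆ range n := fun x hx => mem_range.2 (h.visited_lt hn hx)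
  have heq := eq_of_subset_of_card_le hsub (by rw [card_visited h le_rfl, card_range]; omega)
  exact Set.eq_univ_of_forall fun x => by
    rw [reached, Set.mem_ofPred_eq, heq]
    exact mem_range.2 x.2

/-- `outEdge` reduces cells modulo n only to land in `Fin n`; for the entries of a trace nothing
changes. -/
theorem val_ofNat_of_mem [NeZero n] {T t a : ℕ} (h : PrimTrace n W M T) (ht : t ≤ T)
    (ha : a ∈ visited M t) : (Fin.ofNat n a : ℕ) = a := by
  refine Nat.mod_eq_of_lt (PrimTrace.visited_lt (W := W) (T := t) (M := M) ?_ NeZero.one_le ha)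
  exact fun i hi => h i (by omega)

theorem val_ofNat_fst [NeZero n] {T t : ℕ} (h : PrimTrace n W M T) (ht : t < T) :
    (Fin.ofNat n (M (2 * t)) : ℕ) = M (2 * t) :=
  Nat.mod_eq_of_lt (h t ht).1

theorem val_ofNat_snd [NeZero n] {T t : ℕ} (h : PrimTrace n W M T) (ht : t < T) :
    (Fin.ofNat n (M (2 * t + 1)) : ℕ) = M (2 * t + 1) :=
  val_ofNat_of_mem h ht.le (h t ht).2.2.1

theorem reached_zero [NeZero n] : reached n M 0 = {0} := by
  ext x
  rw [reached, Set.mem_ofPred_eq, Set.mem_singleton_iff, ← Fin.val_eq_zero_iff]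
  simp [visited]

theorem reached_succ [NeZero n] {T t : ℕ} (h : PrimTrace n W M T) (ht : t < T) :
    reached n M (t + 1) = insert (Fin.ofNat n (M (2 * t))) (reached n M t) := by
  ext x
  rw [reached, Set.mem_ofPred_eq, visited_succ, mem_insert, Set.mem_insert_iff, Fin.ext_iff,
    val_ofNat_fst h ht, reached, Set.mem_ofPred_eq]

theorem output_adj [NeZero n] {t : ℕ} (h : PrimTrace n W σ.mem (n - 1)) (ht : t < n - 1) :
    (output n σ).Adj (Fin.ofNat n (σ.mem (2 * t))) (Fin.ofNat n (σ.mem (2 * t + 1))) := by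
  refine (SimpleGraph.fromRel_adj _ _ _).2 ⟨fun e => ?_, Or.inl ⟨t, ht, ?_, ?_⟩⟩
  · rw [Fin.ext_iff, val_ofNat_fst h ht, val_ofNat_snd h ht] at e
    exact (h t ht).2.1 (e ▸ (h t ht).2.2.1)
  · exact (val_ofNat_fst h ht).symm
  · exact (val_ofNat_snd h ht).symm

theorem output_connected [NeZero n] (h : PrimTrace n W σ.mem (n - 1)) :
    (output n σ).Connected := by
  have hn : 1 ≤ n := NeZero.one_le
  have key : ∀ t ≤ n - 1, ∀ x ∈ reached n σ.mem t, (output n σ).Reachable 0 x := by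
    intro t
    induction t with
    | zero =>
      intro _ x hx
      rw [reached_zero] at hx
      rw [hx]
    | succ t ih =>
      intro ht x hx
      rw [reached_succ h ht] at hx
      obtain rfl | hx := hx
      · refine (ih (by omega) _ ?_).trans (output_adj h ht).symm.reachable
        rw [reached, Set.mem_ofPred_eq, val_ofNat_snd h ht]
        exact (h t ht).2.2.1
      · exact ih (by omega) x hx
  rw [SimpleGraph.connected_iff_exists_forall_reachable]
  exact ⟨0, fun x => key _ le_rfl x (by rw [reached_eq_univ hn h]; trivial)⟩

open Classical in
theorem edgeFinset_output_subset [NeZero n] (σ : State) :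
    (output n σ).edgeFinset ⊆ (range (n - 1)).image (outEdge n σ.mem) := by
  intro e
  induction e with | h u v => ?_
  intro he
  have he : (output n σ).Adj u v := SimpleGraph.mem_edgeFinset.1 he
  rw [output, SimpleGraph.fromRel_adj] at he
  obtain ⟨-, ⟨i, hi, h1, h2⟩ | ⟨i, hi, h1, h2⟩⟩ := he
  · refine mem_image.2 ⟨i, mem_range.2 hi, ?_⟩
    simp [outEdge, h1, h2]
  · refine mem_image.2 ⟨i, mem_range.2 hi, ?_⟩
    simp [outEdge, h1, h2, Sym2.eq_swap]

/-- Each new vertex is joined to a visited one, so the graph is connected; it is described by n - 1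
pairs, so it has no edge to spare. -/
theorem output_isTree [NeZero n] (h : PrimTrace n W σ.mem (n - 1)) : (output n σ).IsTree := by
  classical
  have hn : 1 ≤ n := NeZero.one_le
  have hc := output_connected h
  rw [SimpleGraph.isTree_iff_connected_and_card]
  refine ⟨hc, le_antisymm ?_ hc.card_vert_le_card_edgeSet_add_one⟩
  have := (card_le_card (edgeFinset_output_subset (n := n) σ)).trans card_image_le
  rw [card_range, SimpleGraph.edgeFinset_card, ← Nat.card_eq_fintype_card] at this
  rw [Nat.card_fin]
  omega

-- The first t edges of the trace, together with some F connecting the remaining vertices to those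
-- reached, weigh at most as much as H. The next edge is lightest across the cut, so it can replace
-- an edge of F that is at least as heavy.
open Classical in
theorem sum_outEdge_le [NeZero n] (h : PrimTrace n W M (n - 1)) {wt : Sym2 (Fin n) → ℕ}
    (hwt : ∀ x y : Fin n, wt s(x, y) = W x y) (hsymm : ∀ x y, W x y = W y x)
    {H : SimpleGraph (Fin n)} (hH : H.Connected) :
    ∑ t ∈ range (n - 1), wt (outEdge n M t) ≤ ∑ e ∈ H.edgeFinset, wt e := by
  have key : ∀ t ≤ n - 1, ∃ F : Finset (Sym2 (Fin n)), Spans (reached n M t) F ∧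
      ∑ i ∈ range t, wt (outEdge n M i) + ∑ e ∈ F, wt e ≤ ∑ e ∈ H.edgeFinset, wt e := by
    intro t
    induction t with
    | zero =>
      intro _
      exact ⟨H.edgeFinset, by rw [reached_zero]; exact spans_edgeFinset hH 0, by simp⟩
    | succ t ih =>
      intro ht
      obtain ⟨F, hF, hle⟩ := ih (by omega)
      obtain ⟨h1, h2, h3, h4⟩ := h t ht
      obtain ⟨e, he, hce, hsp⟩ := hF.exchange (v := Fin.ofNat n (M (2 * t)))
        (by rwa [reached, Set.mem_ofPred_eq, val_ofNat_fst h ht]) (wt := wt)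
        (c := wt (outEdge n M t)) fun x hx y hy => by
          rw [outEdge, hwt, hwt, val_ofNat_fst h ht, val_ofNat_snd h ht, hsymm]
          exact h4 x hx y y.2 hy
      refine ⟨F.erase e, by rwa [reached_succ h ht], ?_⟩
      rw [← add_sum_erase F wt he] at hle
      rw [sum_range_succ]
      omega
  obtain ⟨F, -, hF⟩ := key _ le_rfl
  omega

/-- The lower bound on W is applied to the edges of the output, the upper bound to those of H, and
minimality for W links the two. -/
theorem cost_output_le [NeZero n] (h : PrimTrace n W σ.mem (n - 1)) (hsymm : ∀ x y, W x y = W y x)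
    {p : Fin n → Fin d → Fin s} {m : ℕ} (hm : 0 < m)
    (hlow : ∀ x y : Fin n, m * hammingDist (p x) (p y) ≤ 8 * W x y)
    (hup : ∀ x y : Fin n, W x y ≤ 2 * m * hammingDist (p x) (p y))
    {H : SimpleGraph (Fin n)} (hH : H.Connected) :
    cost p (output n σ) ≤ 16 * cost p H := by
  classical
  let wt : Sym2 (Fin n) → ℕ := Sym2.lift ⟨fun x y => W x y, fun x y => hsymm x y⟩
  have hlow' : ∀ e, m * edgeLength p e ≤ 8 * wt e := fun e => by
    induction e with | h x y => exact hlow x y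
  have hup' : ∀ e, wt e ≤ 2 * m * edgeLength p e := fun e => by
    induction e with | h x y => exact hup x y
  refine Nat.le_of_mul_le_mul_left ?_ hm
  calc m * cost p (output n σ)
      ≤ m * ∑ t ∈ range (n - 1), edgeLength p (outEdge n σ.mem t) := by
        refine Nat.mul_le_mul_left m ?_
        rw [cost]
        exact (sum_le_sum_of_subset (by convert edgeFinset_output_subset (n := n) σ)).trans
          (sum_image_le_of_nonneg fun _ _ => Nat.zero_le _)
    _ ≤ 8 * ∑ t ∈ range (n - 1), wt (outEdge n σ.mem t) := by
        rw [mul_sum, mul_sum]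
        exact sum_le_sum fun t _ => hlow' _
    _ ≤ 8 * ∑ e ∈ H.edgeFinset, wt e :=
        Nat.mul_le_mul_left 8 (sum_outEdge_le h (fun _ _ => rfl) hsymm hH)
    _ ≤ 8 * ∑ e ∈ H.edgeFinset, 2 * m * edgeLength p e :=
        Nat.mul_le_mul_left 8 (sum_le_sum fun e _ => hup' e)
    _ = m * (16 * cost p H) := by
        rw [cost, ← mul_sum]
        ring

theorem exists_isMinSpanningTree (p : Fin n → Fin d → Fin s) {T : SimpleGraph (Fin n)}
    (hT : T.IsTree) : ∃ M, IsMinSpanningTree p M := by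
  classical
  obtain ⟨M, hM, hmin⟩ := exists_min_image (univ.filter fun T : SimpleGraph (Fin n) => T.IsTree)
    (cost p) ⟨T, by simpa using hT⟩
  exact ⟨M, by simpa using hM, fun T hT => hmin T (by simpa using hT)⟩

end HammingMST

/-! ### Exponential moments of squared Rademacher sums -/

namespace WordRAM

open Finset MeasureTheory

section Moments

theorem exp_sub_add_exp_add_le (x y : ℝ) :
    Real.exp (x - y) + Real.exp (x + y) ≤ 2 * Real.exp (x + y ^ 2 / 2) := by
  have h := Real.cosh_le_exp_half_sq y
  rw [Real.cosh_eq] at h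
  have hx := Real.exp_pos x
  rw [sub_eq_add_neg, Real.exp_add, Real.exp_add, Real.exp_add]
  nlinarith

/-- Averaging over one sign, with x = (a² + c² + S)/M and y = 2ac/M in the bound on cosh. What
remains is (1 + 2c²/M)(1 - 2c²/M) ≤ 1: one sign costs 2c² in the denominator. -/
theorem exp_sq_step {a c S M : ℝ} (hS : 0 ≤ S) (hM : 0 < M - 2 * c ^ 2) :
    Real.exp (((a - c) ^ 2 + S) / M) + Real.exp (((a + c) ^ 2 + S) / M) ≤
      2 * Real.exp ((a ^ 2 + (c ^ 2 + S)) / (M - 2 * c ^ 2)) := by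
  have hM0 : 0 < M := by nlinarith [sq_nonneg c]
  have h := exp_sub_add_exp_add_le ((a ^ 2 + (c ^ 2 + S)) / M) (2 * a * c / M)
  rw [← sub_div, ← add_div, show a ^ 2 + (c ^ 2 + S) - 2 * a * c = (a - c) ^ 2 + S by ring,
    show a ^ 2 + (c ^ 2 + S) + 2 * a * c = (a + c) ^ 2 + S by ring] at h
  refine h.trans (mul_le_mul_of_nonneg_left (Real.exp_le_exp.2 ?_) zero_le_two)
  rw [le_div_iff₀ hM]
  have e : ((a ^ 2 + (c ^ 2 + S)) / M + (2 * a * c / M) ^ 2 / 2) * (M - 2 * c ^ 2) =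
      a ^ 2 + (c ^ 2 + S) - (2 * c ^ 2 * (c ^ 2 + S) * M + 4 * a ^ 2 * c ^ 4) / M ^ 2 := by
    field_simp
    ring
  rw [e]
  have : 0 ≤ (2 * c ^ 2 * (c ^ 2 + S) * M + 4 * a ^ 2 * c ^ 4) / M ^ 2 := by positivity
  linarith

/-- As before, now resting on (1 - 2c²/M)(1 + 4c²/M) ≥ 1, which is where 4c² ≤ M is needed. -/
theorem exp_neg_sq_step {a c S M : ℝ} (hS : 0 ≤ S) (hM : 4 * c ^ 2 ≤ M) (hM0 : 0 < M) :
    Real.exp (-(((a - c) ^ 2 + S) / M)) + Real.exp (-(((a + c) ^ 2 + S) / M)) ≤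
      2 * Real.exp (-((a ^ 2 + (c ^ 2 + S)) / (M + 4 * c ^ 2))) := by
  have h := exp_sub_add_exp_add_le (-((a ^ 2 + (c ^ 2 + S)) / M)) (2 * a * c / M)
  rw [show -((a ^ 2 + (c ^ 2 + S)) / M) - 2 * a * c / M = -(((a + c) ^ 2 + S) / M) by ring,
    show -((a ^ 2 + (c ^ 2 + S)) / M) + 2 * a * c / M = -(((a - c) ^ 2 + S) / M) by ring,
    add_comm] at h
  refine h.trans (mul_le_mul_of_nonneg_left (Real.exp_le_exp.2 ?_) zero_le_two)
  have hM4 : 0 < M + 4 * c ^ 2 := by positivity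
  rw [le_neg, div_le_iff₀ hM4]
  have e : -(-((a ^ 2 + (c ^ 2 + S)) / M) + (2 * a * c / M) ^ 2 / 2) * (M + 4 * c ^ 2) =
      a ^ 2 + (c ^ 2 + S) + (4 * c ^ 2 * (c ^ 2 + S) * M + 2 * a ^ 2 * c ^ 2 * (M - 4 * c ^ 2)) /
        M ^ 2 := by
    field_simp
    ring
  rw [e]
  have h0 : 0 ≤ M - 4 * c ^ 2 := by linarith
  have : 0 ≤ (4 * c ^ 2 * (c ^ 2 + S) * M + 2 * a ^ 2 * c ^ 2 * (M - 4 * c ^ 2)) / M ^ 2 := by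
    positivity
  linarith

variable {ι : Type*}

/-- A subset T encodes the signs, + on T and - off T, so the argument of f is a plus a signed sum.
Splitting off the sign of q shifts a by ±c q, which is why the induction keeps a general offset. -/
theorem sum_powerset_insert_shift [DecidableEq ι] {U : Finset ι} {q : ι} (hq : q ∉ U) (c : ι → ℝ) (a : ℝ)
    (f : ℝ → ℝ) :
    ∑ T ∈ (insert q U).powerset, f (a + 2 * ∑ i ∈ T, c i - ∑ i ∈ insert q U, c i) =
      ∑ T ∈ U.powerset, f (a - c q + 2 * ∑ i ∈ T, c i - ∑ i ∈ U, c i) +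
      ∑ T ∈ U.powerset, f (a + c q + 2 * ∑ i ∈ T, c i - ∑ i ∈ U, c i) := by
  rw [sum_powerset_insert hq]
  congr 1
  · refine sum_congr rfl fun T _ => ?_
    rw [sum_insert hq]
    congr 1
    ring
  · refine sum_congr rfl fun T hT => ?_
    rw [sum_insert hq, sum_insert fun h => hq (mem_powerset.1 hT h)]
    congr 1
    ring

theorem sum_exp_sq_le [DecidableEq ι] (c : ι → ℝ) (L : ℝ) (U : Finset ι) :
    ∀ a : ℝ, 0 < L - 2 * ∑ i ∈ U, c i ^ 2 →
    ∑ T ∈ U.powerset, Real.exp ((a + 2 * ∑ i ∈ T, c i - ∑ i ∈ U, c i) ^ 2 / L) ≤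
      2 ^ #U * Real.exp ((a ^ 2 + ∑ i ∈ U, c i ^ 2) / (L - 2 * ∑ i ∈ U, c i ^ 2)) := by
  induction U using Finset.induction_on with
  | empty => intro a _; simp
  | insert q U hq ih =>
    intro a hL
    rw [sum_powerset_insert_shift hq c a fun x => Real.exp (x ^ 2 / L)]
    rw [sum_insert hq] at hL
    have hL' : 0 < L - 2 * ∑ i ∈ U, c i ^ 2 := by nlinarith [sq_nonneg (c q)]
    refine (add_le_add (ih (a - c q) hL') (ih (a + c q) hL')).trans ?_
    rw [card_insert_of_notMem hq, pow_succ (2 : ℝ), mul_assoc, ← mul_add, sum_insert hq]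
    refine mul_le_mul_of_nonneg_left ?_ (by positivity)
    rw [show L - 2 * (c q ^ 2 + ∑ i ∈ U, c i ^ 2) = L - 2 * ∑ i ∈ U, c i ^ 2 - 2 * c q ^ 2 by ring]
    exact exp_sq_step (sum_nonneg fun _ _ => sq_nonneg _) (by linarith)

theorem sum_exp_neg_sq_le [DecidableEq ι] (c : ι → ℝ) (hc : ∀ i, c i ^ 2 ≤ 1) (L : ℝ) (hL : 4 ≤ L) (U : Finset ι) :
    ∀ a : ℝ, ∑ T ∈ U.powerset, Real.exp (-((a + 2 * ∑ i ∈ T, c i - ∑ i ∈ U, c i) ^ 2 / L)) ≤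
      2 ^ #U * Real.exp (-((a ^ 2 + ∑ i ∈ U, c i ^ 2) / (L + 4 * ∑ i ∈ U, c i ^ 2))) := by
  induction U using Finset.induction_on with
  | empty => intro a; simp
  | insert q U hq ih =>
    intro a
    rw [sum_powerset_insert_shift hq c a fun x => Real.exp (-(x ^ 2 / L))]
    refine (add_le_add (ih (a - c q)) (ih (a + c q))).trans ?_
    rw [card_insert_of_notMem hq, pow_succ (2 : ℝ), mul_assoc, ← mul_add, sum_insert hq]
    refine mul_le_mul_of_nonneg_left ?_ (by positivity)
    have hS : 0 ≤ ∑ i ∈ U, c i ^ 2 := sum_nonneg fun _ _ => sq_nonneg _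
    rw [show L + 4 * (c q ^ 2 + ∑ i ∈ U, c i ^ 2) = L + 4 * ∑ i ∈ U, c i ^ 2 + 4 * c q ^ 2 by ring]
    exact exp_neg_sq_step hS (by linarith [hc q]) (by linarith)

variable [Fintype ι]

/-- The Chernoff bound in counting form: the exponential moment of a sum over independent rounds is
an m-th power. -/
theorem card_le_of_sum_exp_le {m : ℕ} {f : Finset ι → ℝ} {b θ : ℝ}
    (hf : ∑ T, Real.exp (f T) ≤ 2 ^ Fintype.card ι * Real.exp b)
    {B : Finset (Fin m → Finset ι)} (hB : ∀ t ∈ B, θ ≤ ∑ k, f (t k)) :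
    (#B : ℝ) ≤ (2 ^ Fintype.card ι) ^ m * Real.exp (m * b - θ) := by
  have h1 : #B * Real.exp θ ≤ ∑ t : Fin m → Finset ι, Real.exp (∑ k, f (t k)) := by
    rw [← nsmul_eq_mul]
    exact (card_nsmul_le_sum B _ _ fun t ht => Real.exp_le_exp.2 (hB t ht)).trans
      (sum_le_sum_of_subset_of_nonneg (subset_univ _) fun _ _ _ => (Real.exp_pos _).le)
  have h2 : ∑ t : Fin m → Finset ι, Real.exp (∑ k, f (t k)) = (∑ T, Real.exp (f T)) ^ m := by
    simp_rw [Real.exp_sum]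
    rw [← Fintype.piFinset_univ, ← prod_univ_sum (fun _ : Fin m => univ) fun _ T => Real.exp (f T)]
    simp
  have h3 : (∑ T, Real.exp (f T)) ^ m ≤ (2 ^ Fintype.card ι * Real.exp b) ^ m :=
    pow_le_pow_left₀ (sum_nonneg fun _ _ => (Real.exp_pos _).le) hf m
  rw [mul_pow, ← Real.exp_nat_mul] at h3
  rw [Real.exp_sub, ← mul_div_assoc, le_div_iff₀ (Real.exp_pos _)]
  exact h1.trans (h2.le.trans h3)

end Moments

/-! ### From the random tape to uniform tuples of subsets -/

section Tape

variable {w : ℕ}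

instance : IsProbabilityMeasure (tapeLaw w) := by
  unfold tapeLaw
  infer_instance

theorem card_filter_odd_iff (w : ℕ) (P : Prop) [Decidable P] :
    #{v : Fin (2 ^ (w + 1)) | (v : ℕ) % 2 = 1 ↔ P} = 2 ^ w := by
  rw [card_filter]
  have := Equiv.sum_comp (finProdFinEquiv (m := 2 ^ w) (n := 2))
    (fun v => if (v : ℕ) % 2 = 1 ↔ P then 1 else 0)
  refine (this.symm.trans ?_)
  rw [Fintype.sum_prod_type]
  simp only [finProdFinEquiv_apply_val, Fin.sum_univ_two, Nat.add_mul_mod_self_left]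
  by_cases hP : P <;> simp [hP]

theorem uniform_parity (hw : 1 < 2 ^ w) (P : Prop) :
    (PMF.uniformOfFintype (Fin (2 ^ w))).toMeasure {v | (v : ℕ) % 2 = 1 ↔ P} = 2⁻¹ := by
  classical
  obtain ⟨w, rfl⟩ : ∃ k, w = k + 1 := Nat.exists_eq_succ_of_ne_zero (by rintro rfl; simp at hw)
  rw [PMF.toMeasure_uniformOfFintype_apply _ (MeasurableSet.of_discrete)]
  have h : Fintype.card {v : Fin (2 ^ (w + 1)) | (v : ℕ) % 2 = 1 ↔ P} = 2 ^ w := by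
    rw [← card_filter_odd_iff w P, ← Fintype.card_subtype]
    exact Fintype.card_congr (Equiv.refl _)
  rw [h, Fintype.card_fin, pow_succ, Nat.cast_mul, ENNReal.div_eq_inv_mul,
    ENNReal.mul_inv (by simp) (by simp), mul_comm, ← mul_assoc,
    ENNReal.mul_inv_cancel (by simp) (by simp), one_mul, Nat.cast_ofNat]

variable {ι : Type*} [Fintype ι] {m : ℕ}

/-- The indices whose bits are set in the rounds of a sketch with the tape `ω`. -/
def tapeSets (idx : Fin m → ι → ℕ) (ω : ℕ → Fin (2 ^ w)) (k : Fin m) : Finset ι :=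
  {q | (ω (idx k q) : ℕ) % 2 = 1}

theorem tapeLaw_tapeSets_eq (hw : 1 < 2 ^ w) {idx : Fin m → ι → ℕ}
    (hidx : Function.Injective (Function.uncurry idx)) (t : Fin m → Finset ι) :
    tapeLaw w {ω | tapeSets idx ω = t} = 2⁻¹ ^ (m * Fintype.card ι) := by
  classical
  -- The event is a cylinder that prescribes parities at the positions in use. Injectivity of the
  -- indexing makes the prescriptions consistent and their number m times the number of indices.
  have : {ω : ℕ → Fin (2 ^ w) | tapeSets idx ω = t} =
      Set.pi (univ.image (Function.uncurry idx) : Finset ℕ)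
        fun i => {v : Fin (2 ^ w) | (v : ℕ) % 2 = 1 ↔ ∃ k, ∃ q ∈ t k, idx k q = i} := by
    ext ω
    simp only [Set.mem_ofPred_eq, Set.mem_pi, coe_image, coe_univ, Set.image_univ, Set.mem_range,
      Prod.exists, Function.uncurry_apply_pair, forall_exists_index]
    constructor
    · rintro rfl i k q rfl
      refine ⟨fun h => ⟨k, q, by simpa [tapeSets] using h, rfl⟩, ?_⟩
      rintro ⟨k', q', h, e⟩
      rw [← e]
      simpa [tapeSets] using h
    · intro h
      funext k
      ext q
      simp only [tapeSets, mem_filter, mem_univ, true_and]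
      rw [h _ k q rfl]
      constructor
      · rintro ⟨k', q', hq, e⟩
        obtain ⟨rfl, rfl⟩ := Prod.mk.inj (hidx (a₁ := (k', q')) (a₂ := (k, q)) e)
        exact hq
      · exact fun hq => ⟨k, q, hq, rfl⟩
  rw [this, tapeLaw, Measure.infinitePi_pi _ fun _ _ => MeasurableSet.of_discrete]
  simp only [uniform_parity hw, prod_const]
  rw [card_image_of_injective _ hidx, card_univ, Fintype.card_prod, Fintype.card_fin]

theorem tapeLaw_real_tapeSets_le (hw : 1 < 2 ^ w) {idx : Fin m → ι → ℕ}
    (hidx : Function.Injective (Function.uncurry idx)) {f : Finset ι → ℝ} {b θ : ℝ}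
    (hf : ∑ T, Real.exp (f T) ≤ 2 ^ Fintype.card ι * Real.exp b) :
    (tapeLaw w).real {ω | θ ≤ ∑ k, f (tapeSets idx ω k)} ≤ Real.exp (m * b - θ) := by
  classical
  let B : Finset (Fin m → Finset ι) := {t | θ ≤ ∑ k, f (t k)}
  have h1 : (tapeLaw w).real {ω | θ ≤ ∑ k, f (tapeSets idx ω k)} ≤
      ∑ t ∈ B, (tapeLaw w).real {ω | tapeSets idx ω = t} := by
    refine (measureReal_mono (fun ω hω => ?_) (measure_ne_top _ _)).trans (measureReal_biUnion_finset_le B _)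
    exact Set.mem_biUnion (x := tapeSets idx ω) (by simpa [B] using hω) rfl
  have h2 : ∀ t, (tapeLaw w).real {ω | tapeSets idx ω = t} = ((2 ^ Fintype.card ι) ^ m)⁻¹ := by
    intro t
    rw [measureReal_def, tapeLaw_tapeSets_eq hw hidx]
    simp [← pow_mul, Nat.mul_comm]
  simp only [h2, sum_const, nsmul_eq_mul] at h1
  refine h1.trans ?_
  have h3 := card_le_of_sum_exp_le (θ := θ) hf (B := B) fun t ht => by simpa [B] using ht
  rwa [← div_eq_mul_inv, div_le_iff₀' (by positivity)]

end Tape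

end WordRAM

/-! ### Accuracy of the estimates and the bounds of the theorem -/

namespace HammingMST

open Finset WordRAM MeasureTheory

variable {n d s w m : ℕ} {ω : ℕ → Fin (2 ^ w)}

/-- The coefficients of the random bits in the difference of the projections of two points. -/
def coeff (p : Fin n → Fin d → Fin s) (x y : Fin n) (q : Fin d × Fin s) : ℝ :=
  (if p x q.1 = q.2 then 1 else 0) - if p y q.1 = q.2 then 1 else 0

theorem coeff_sq_le_one (p : Fin n → Fin d → Fin s) (x y : Fin n) (q : Fin d × Fin s) :
    coeff p x y q ^ 2 ≤ 1 := by
  unfold coeff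
  split_ifs <;> norm_num

theorem sum_coeff (p : Fin n → Fin d → Fin s) (x y : Fin n) : ∑ q, coeff p x y q = 0 := by
  simp only [coeff, Fintype.sum_prod_type, sum_sub_distrib, sum_ite_eq, mem_univ, if_true, sub_self]

/-- A coordinate where the points differ contributes one coefficient 1 and one -1; all other
coordinates cancel. -/
theorem sum_coeff_sq (p : Fin n → Fin d → Fin s) (x y : Fin n) :
    ∑ q, coeff p x y q ^ 2 = 2 * hammingDist (p x) (p y) := by
  have h : ∀ u v : Fin s, ∑ a, (((if u = a then 1 else 0) - if v = a then 1 else 0 : ℝ)) ^ 2 =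
      if u ≠ v then 2 else 0 := by
    intro u v
    have e : ∀ a, (((if u = a then 1 else 0) - if v = a then 1 else 0 : ℝ)) ^ 2 =
        (if u = a then 1 else 0) + (if v = a then 1 else 0) -
          if u = a then (if v = a then 2 else 0) else 0 := by
      intro a
      split_ifs <;> norm_num
    simp_rw [e, sum_sub_distrib, sum_add_distrib]
    by_cases huv : u = v
    · simp [huv]
      norm_num
    · simp [huv, Ne.symm huv]
      norm_num
  simp only [coeff, Fintype.sum_prod_type, h]
  rw [← sum_filter, sum_const, nsmul_eq_mul, mul_comm, hammingDist]

/-- The tape positions of the bits of a sketch. -/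
def tapeIndex (m d s : ℕ) (k : Fin m) (q : Fin d × Fin s) : ℕ := k * (d * s) + (q.1 * s + q.2)

theorem tapeIndex_injective : Function.Injective (Function.uncurry (tapeIndex m d s)) := by
  have key : ∀ {b a a' r r' : ℕ}, r < b → r' < b → a * b + r = a' * b + r' → a = a' ∧ r = r' := by
    intro b a a' r r' hr hr' h
    have hb : 0 < b := by omega
    have h1 := congrArg (· / b) h
    simp only [Nat.mul_comm _ b, Nat.mul_add_div hb, Nat.div_eq_of_lt hr, Nat.div_eq_of_lt hr',
      Nat.add_zero] at h1
    subst h1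
    exact ⟨rfl, by omega⟩
  rintro ⟨k, j, a⟩ ⟨k', j', a'⟩ h
  obtain ⟨h1, h2⟩ := key (mul_add_lt j.2 a.2) (mul_add_lt j'.2 a'.2) h
  obtain ⟨h3, h4⟩ := key a.2 a'.2 h2
  exact Prod.ext (Fin.ext h1) (Prod.ext (Fin.ext h3) (Fin.ext h4))

theorem input_mem (p : Fin n → Fin d → Fin s) (hs : s ≤ 2 ^ w) (x : Fin n) (j : Fin d) :
    (input w p).mem (x * d + j) = p x j := by
  have h := mul_add_lt x.2 j.2
  have h1 : (x * d + j : ℕ) / d = x := by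
    rw [Nat.mul_comm, Nat.mul_add_div (by omega), Nat.div_eq_of_lt j.2, Nat.add_zero]
  have h2 : (x * d + j : ℕ) % d = j := by rw [Nat.mul_comm, Nat.mul_add_mod, Nat.mod_eq_of_lt j.2]
  simp only [input, h, dif_pos, h1, h2, Fin.eta]
  exact Nat.mod_eq_of_lt ((p x j).2.trans_le hs)

theorem input_mem_lt (p : Fin n → Fin d → Fin s) {a : ℕ} (ha : a < n * d) :
    (input w p).mem a < s := by
  simp only [input, ha, dif_pos]
  exact (Nat.mod_le _ _).trans_lt (Fin.is_lt _)

theorem input_mem_eq_zero (p : Fin n → Fin d → Fin s) {a : ℕ} (ha : n * d ≤ a) :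
    (input w p).mem a = 0 :=
  dif_neg (by omega)

theorem projection_input (p : Fin n → Fin d → Fin s) (hs : s ≤ 2 ^ w) (x : Fin n) (k : Fin m) :
    (projection ω (input w p).mem d s k x : ℝ) =
      ∑ q ∈ tapeSets (tapeIndex m d s) ω k, if p x q.1 = q.2 then 1 else 0 := by
  rw [projection, sum_range, tapeSets, sum_filter, Fintype.sum_prod_type, Nat.cast_sum]
  refine sum_congr rfl fun j _ => ?_
  rw [input_mem p hs x j, Finset.sum_eq_single (p x j) ?_ (by simp)]
  · simp only [tapeIndex, if_true]
    split_ifs with h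
    · rw [h, Nat.cast_one]
    · rw [show (ω (k * (d * s) + (j * s + p x j)) : ℕ) % 2 = 0 by omega, Nat.cast_zero]
  · intro a _ ha
    rw [if_neg (Ne.symm ha), ite_self]

theorem cast_sqDiff (a b : ℕ) : (sqDiff a b : ℝ) = (a - b) ^ 2 := by
  rw [sqDiff, Nat.cast_sub (two_mul_le_sq a b)]
  push_cast
  ring

theorem estimate_input (p : Fin n → Fin d → Fin s) (hs : s ≤ 2 ^ w) (x y : Fin n) (m : ℕ) :
    (estimate ω (input w p).mem d s m x y : ℝ) =
      ∑ k : Fin m, (∑ q ∈ tapeSets (tapeIndex m d s) ω k, coeff p x y q) ^ 2 := by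
  rw [estimate, sum_range, Nat.cast_sum]
  refine sum_congr rfl fun k _ => ?_
  rw [cast_sqDiff, projection_input p hs, projection_input p hs, ← sum_sub_distrib]
  rfl

/-- Coinciding points are treated apart because the moment bounds are scaled by the distance. -/
theorem estimate_input_of_hammingDist_eq_zero (p : Fin n → Fin d → Fin s) (hs : s ≤ 2 ^ w)
    {x y : Fin n} (h : hammingDist (p x) (p y) = 0) (m : ℕ) :
    estimate ω (input w p).mem d s m x y = 0 := by
  have hxy := hammingDist_eq_zero.1 h
  have := estimate_input (ω := ω) p hs x y m
  simpa [coeff, hxy] using this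

theorem tapeLaw_estimate_gt_le (p : Fin n → Fin d → Fin s) (hs : s ≤ 2 ^ w) (hw : 1 < 2 ^ w)
    (x y : Fin n) (m : ℕ) :
    (tapeLaw w).real {ω | ¬ estimate ω (input w p).mem d s m x y ≤
      2 * m * hammingDist (p x) (p y)} ≤ Real.exp (-(m / 16)) := by
  by_cases h0 : hammingDist (p x) (p y) = 0
  · simp only [estimate_input_of_hammingDist_eq_zero p hs h0, Nat.zero_le, not_true_eq_false]
    simpa using (Real.exp_pos _).le
  have hh : (0 : ℝ) < hammingDist (p x) (p y) := by exact_mod_cast Nat.pos_of_ne_zero h0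
  set h : ℝ := ((hammingDist (p x) (p y) : ℕ) : ℝ) with hdef
  -- With L = 8h and square sum 2h the moment is at most exp(1/2). The threshold θ = m corresponds
  -- to an estimate of 2mh, since the signed sum is twice the difference of the projections.
  have hmgf := sum_exp_sq_le (coeff p x y) (8 * h) univ 0 (by rw [sum_coeff_sq]; linarith)
  rw [sum_coeff_sq, sum_coeff, powerset_univ, card_univ, ← hdef,
    show ((0 : ℝ) ^ 2 + 2 * h) / (8 * h - 2 * (2 * h)) = 1 / 2 by field_simp; norm_num; ring] at hmgf
  have key := tapeLaw_real_tapeSets_le (m := m) (θ := m) hw tapeIndex_injective hmgf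
  refine (measureReal_mono (fun ω hω => ?_) (measure_ne_top _ _)).trans (key.trans
    (Real.exp_le_exp.2 (by linarith [Nat.cast_nonneg (α := ℝ) m])))
  have hω : ¬ (estimate ω (input w p).mem d s m x y ≤ 2 * m * hammingDist (p x) (p y)) := hω
  have hlt : 2 * m * h < (estimate ω (input w p).mem d s m x y : ℝ) := by
    rw [hdef]
    exact_mod_cast not_le.1 hω
  rw [estimate_input p hs] at hlt
  rw [Set.mem_ofPred_eq, ← sum_div, le_div_iff₀ (by positivity)]
  have e : ∀ z : ℝ, (0 + 2 * z - 0) ^ 2 = 4 * z ^ 2 := fun z => by ring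
  simp_rw [e, ← mul_sum]
  linarith

theorem tapeLaw_estimate_lt_le (p : Fin n → Fin d → Fin s) (hs : s ≤ 2 ^ w) (hw : 1 < 2 ^ w)
    (x y : Fin n) (m : ℕ) :
    (tapeLaw w).real {ω | ¬ m * hammingDist (p x) (p y) ≤
      8 * estimate ω (input w p).mem d s m x y} ≤ Real.exp (-(m / 16)) := by
  by_cases h0 : hammingDist (p x) (p y) = 0
  · simp only [h0, Nat.mul_zero, Nat.zero_le, not_true_eq_false]
    simpa using (Real.exp_pos _).le
  have hh1 : (1 : ℝ) ≤ hammingDist (p x) (p y) := by exact_mod_cast Nat.pos_of_ne_zero h0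
  set h : ℝ := ((hammingDist (p x) (p y) : ℕ) : ℝ) with hdef
  have hh : 0 < h := by linarith
  -- With L = 8h the moment is at most exp(-1/8). The threshold -m/16 corresponds to an estimate of
  -- mh/8 and leaves exp(-m/8 + m/16).
  have hmgf := sum_exp_neg_sq_le (coeff p x y) (coeff_sq_le_one p x y) (8 * h) (by linarith) univ 0
  rw [sum_coeff_sq, sum_coeff, powerset_univ, card_univ, ← hdef,
    show ((0 : ℝ) ^ 2 + 2 * h) / (8 * h + 4 * (2 * h)) = 1 / 8 by field_simp; norm_num; ring] at hmgf
  have key := tapeLaw_real_tapeSets_le (m := m) (θ := -(m / 16)) hw tapeIndex_injective hmgf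
  refine (measureReal_mono (fun ω hω => ?_) (measure_ne_top _ _)).trans (key.trans
    (Real.exp_le_exp.2 (by linarith [Nat.cast_nonneg (α := ℝ) m])))
  have hω : ¬ (m * hammingDist (p x) (p y) ≤ 8 * estimate ω (input w p).mem d s m x y) := hω
  have hlt : 8 * (estimate ω (input w p).mem d s m x y : ℝ) < m * h := by
    rw [hdef]
    exact_mod_cast not_le.1 hω
  rw [estimate_input p hs] at hlt
  rw [Set.mem_ofPred_eq, sum_neg_distrib, neg_le_neg_iff, ← sum_div, div_le_iff₀ (by positivity)]
  have e : ∀ z : ℝ, (0 + 2 * z - 0) ^ 2 = 4 * z ^ 2 := fun z => by ring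
  simp_rw [e, ← mul_sum]
  linarith

/-- The tapes for which all estimates are good up to a constant factor. -/
def goodTapes (w : ℕ) (p : Fin n → Fin d → Fin s) (m : ℕ) : Set (ℕ → Fin (2 ^ w)) :=
  {ω | ∀ x y : Fin n,
    m * hammingDist (p x) (p y) ≤ 8 * estimate ω (input w p).mem d s m x y ∧
    estimate ω (input w p).mem d s m x y ≤ 2 * m * hammingDist (p x) (p y)}

theorem le_tapeLaw_goodTapes (p : Fin n → Fin d → Fin s) (hs : s ≤ 2 ^ w) (hw : 1 < 2 ^ w)
    (m : ℕ) : 1 - 2 * (n : ℝ) ^ 2 * Real.exp (-(m / 16)) ≤ (tapeLaw w).real (goodTapes w p m) := by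
  let E : Fin n × Fin n → Set (ℕ → Fin (2 ^ w)) := fun q =>
    {ω | ¬ m * hammingDist (p q.1) (p q.2) ≤ 8 * estimate ω (input w p).mem d s m q.1 q.2} ∪
    {ω | ¬ estimate ω (input w p).mem d s m q.1 q.2 ≤ 2 * m * hammingDist (p q.1) (p q.2)}
  have hE : ∀ q, (tapeLaw w).real (E q) ≤ 2 * Real.exp (-(m / 16)) := fun q => by
    refine (measureReal_union_le _ _).trans ?_
    linarith [tapeLaw_estimate_gt_le p hs hw q.1 q.2 m, tapeLaw_estimate_lt_le p hs hw q.1 q.2 m]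
  have hcover : Set.univ ⊆ goodTapes w p m ∪ ⋃ q ∈ (univ : Finset (Fin n × Fin n)), E q := by
    intro ω _
    by_cases hω : ω ∈ goodTapes w p m
    · exact Or.inl hω
    · right
      have hω : ¬ ∀ x y : Fin n,
        m * hammingDist (p x) (p y) ≤ 8 * estimate ω (input w p).mem d s m x y ∧
        estimate ω (input w p).mem d s m x y ≤ 2 * m * hammingDist (p x) (p y) := hω
      push Not at hω
      obtain ⟨x, y, hxy⟩ := hω
      refine Set.mem_biUnion (x := (x, y)) (by simp) ?_
      by_cases h : m * hammingDist (p x) (p y) ≤ 8 * estimate ω (input w p).mem d s m x y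
      · exact Or.inr (not_le.2 (hxy h))
      · exact Or.inl h
  have h1 : 1 ≤ (tapeLaw w).real (goodTapes w p m ∪ ⋃ q ∈ (univ : Finset (Fin n × Fin n)), E q) := by
    rw [← probReal_univ (μ := tapeLaw w)]
    exact measureReal_mono hcover (measure_ne_top _ _)
  have h2 := h1.trans (measureReal_union_le _ _)
  have h3 := (measureReal_biUnion_finset_le (μ := tapeLaw w) univ E).trans
    (sum_le_sum fun q _ => hE q)
  rw [sum_const, card_univ, Fintype.card_prod, Fintype.card_fin, nsmul_eq_mul, Nat.cast_mul] at h3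
  nlinarith

theorem failure_le {α : ℝ} {A : ℕ} (hA : 16 * (α + 3) ≤ A) (hd : 1 ≤ d)
    (hnd : 2 ≤ n * d) :
    2 * (n : ℝ) ^ 2 * Real.exp (-((A * (Nat.log 2 (n * d) + 1) : ℕ) / 16)) ≤
      1 / ((n : ℝ) * d) ^ α := by
  set x : ℝ := (n : ℝ) * d with hx
  have hx2 : 2 ≤ x := by rw [hx]; exact_mod_cast hnd
  have hnx : (n : ℝ) ≤ x := by
    rw [hx]; exact_mod_cast Nat.le_mul_of_pos_right n hd
  set l := Nat.log 2 (n * d) + 1 with hl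
  have hlog : Real.log x ≤ l := by
    have h1 : x ≤ 2 ^ l := by
      rw [hx]; exact_mod_cast (Nat.lt_pow_succ_log_self (by norm_num) (n * d)).le
    have h2 : Real.log x ≤ l * Real.log 2 := by
      rw [← Real.log_pow]
      exact Real.log_le_log (by linarith) h1
    have h3 : Real.log 2 ≤ 1 := by linarith [Real.log_two_lt_d9]
    nlinarith [Nat.cast_nonneg (α := ℝ) l]
  have hlog0 : 0 ≤ Real.log x := Real.log_nonneg (by linarith)
  have hexp : Real.exp (-((A * l : ℕ) / 16)) ≤ x ^ (-(α + 3)) := by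
    rw [Real.rpow_def_of_pos (by linarith), Real.exp_le_exp]
    push_cast
    have : (α + 3) * Real.log x ≤ A / 16 * l :=
      mul_le_mul (by linarith) hlog hlog0 (by positivity)
    linarith
  have hx0 : 0 < x := by linarith
  rw [neg_add, Real.rpow_add hx0, Real.rpow_neg hx0.le, Real.rpow_neg hx0.le] at hexp
  rw [one_div]
  have hn0 : (0 : ℝ) ≤ n := Nat.cast_nonneg n
  -- The union bound costs 2n² ≤ x³ because x ≥ 2; this is the 3 in 16(α + 3).
  have h3 : 2 * (n : ℝ) ^ 2 ≤ x ^ (3 : ℝ) := by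
    rw [show (3 : ℝ) = ((3 : ℕ) : ℝ) by norm_num, Real.rpow_natCast]
    nlinarith [pow_le_pow_left₀ hn0 hnx 2, sq_nonneg x]
  have hxα : 0 < (x ^ α)⁻¹ := by positivity
  have hx3 : 0 < x ^ (3 : ℝ) := by positivity
  calc 2 * (n : ℝ) ^ 2 * Real.exp (-((A * l : ℕ) / 16))
      ≤ x ^ (3 : ℝ) * ((x ^ α)⁻¹ * (x ^ (3 : ℝ))⁻¹) :=
        mul_le_mul h3 hexp (Real.exp_pos _).le hx3.le
    _ = (x ^ α)⁻¹ := by field_simp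

theorem time_le (A : ℕ) (hn : 1 ≤ n) (hd : 1 ≤ d) :
    ((300 * (A * (Nat.log 2 (n * d) + 1)) * (d * s + n * d + n * n) : ℕ) : ℝ) ≤
      600 * A * (s + 1) * timeBound n d := by
  have hnd : 1 ≤ n * d := Nat.mul_pos hn hd
  have h1 : ∀ x, 1 ≤ lg x := fun x => le_max_left _ _
  have hl : ((Nat.log 2 (n * d) + 1 : ℕ) : ℝ) ≤ 2 * lg (n * d) := by
    have h2 : (Nat.log 2 (n * d) : ℝ) ≤ Real.logb 2 (n * d) := by
      have := Real.natLog_le_logb (n * d) 2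
      push_cast at this
      exact this
    have h3 : Real.logb 2 (n * d) ≤ lg (n * d) := le_max_right _ _
    push_cast
    linarith [h1 (n * d)]
  have hB : ((d * s + n * d + n * n : ℕ) : ℝ) ≤
      (s + 1) * (n * d * lg d + (n : ℝ) ^ 2 * lg (lg d)) := by
    have hnr : (1 : ℝ) ≤ n := by exact_mod_cast hn
    have hdr : (1 : ℝ) ≤ d := by exact_mod_cast hd
    have hs0 : (0 : ℝ) ≤ s := Nat.cast_nonneg s
    have e1 : (n : ℝ) * d ≤ n * d * lg d := le_mul_of_one_le_right (by positivity) (h1 _)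
    have e2 : (n : ℝ) ^ 2 ≤ (n : ℝ) ^ 2 * lg (lg d) := le_mul_of_one_le_right (by positivity) (h1 _)
    have e3 : (d : ℝ) * s ≤ s * (n * d) := by
      nlinarith [mul_nonneg hs0 (by linarith : (0 : ℝ) ≤ d)]
    have e4 : (s + 1 : ℝ) * (n * d + (n : ℝ) ^ 2) ≤
        (s + 1) * (n * d * lg d + (n : ℝ) ^ 2 * lg (lg d)) :=
      mul_le_mul_of_nonneg_left (add_le_add e1 e2) (by positivity)
    push_cast
    nlinarith [mul_nonneg hs0 (sq_nonneg (n : ℝ))]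
  rw [Nat.cast_mul, Nat.cast_mul, Nat.cast_mul, timeBound, Nat.cast_ofNat]
  calc 300 * ((A : ℝ) * ((Nat.log 2 (n * d) + 1 : ℕ) : ℝ)) * ((d * s + n * d + n * n : ℕ) : ℝ)
      ≤ 300 * ((A : ℝ) * (2 * lg (n * d))) *
          ((s + 1) * (n * d * lg d + (n : ℝ) ^ 2 * lg (lg d))) := by
        have := h1 (n * d)
        gcongr
    _ = _ := by ring

end HammingMST

/-- There is an absolute constant `C` such that for every exponent `α ≥ 1` there is a randomized
word-RAM program which, for every fixed alphabet size `s`, on words of at least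
`log₂ (κ (n d s) ^ κ)` bits, always halts within `K` times the time bound, with `K` depending only
on `s` and `α`, always outputs a spanning tree, and outputs with probability at least
`1 - 1 / (n d) ^ α` one whose cost is within the factor `C (log₂ s + 1)` of the minimum. -/
theorem mainTheorem10 :
    ∃ C : ℝ, ∀ α : ℝ, 1 ≤ α →
      ∃ (P : WordRAM.Program) (κ : ℕ), ∀ s : ℕ, ∃ K : ℝ, ∀ n d w : ℕ, 1 ≤ n → 1 ≤ d →
        κ * (n * d * s) ^ κ ≤ 2 ^ w → ∀ p : Fin n → Fin d → Fin s,
          (∀ ω : ℕ → Fin (2 ^ w), ∃ σ t, WordRAM.Exec w ω P (HammingMST.input w p) σ t ∧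
            (t : ℝ) ≤ K * HammingMST.timeBound n d ∧ (HammingMST.output n σ).IsTree) ∧
          1 - 1 / ((n : ℝ) * d) ^ α ≤
            (WordRAM.tapeLaw w).real {ω | ∃ σ t,
              WordRAM.Exec w ω P (HammingMST.input w p) σ t ∧
              HammingMST.IsApproxSpanningTree p (C * (Real.logb 2 s + 1))
                (HammingMST.output n σ)} := by
  refine ⟨16, fun α hα => ?_⟩
  set A := ⌈16 * (α + 3)⌉₊ with hAdef
  have hA : 16 * (α + 3) ≤ A := Nat.le_ceil _
  have hA1 : 1 ≤ A := by
    have : (1 : ℝ) ≤ A := by linarith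
    exact_mod_cast this
  -- The constant A + 20 serves as coefficient and as exponent of the word size bound; an exponent
  -- of 3 would do.
  refine ⟨WordRAM.sketchMST A, A + 20, fun s => ⟨600 * A * (s + 1), fun n d w hn hd hw p => ?_⟩⟩
  have : NeZero n := ⟨by omega⟩
  have hs : 1 ≤ s := (p ⟨0, hn⟩ ⟨0, hd⟩).pos
  have hN : 1 ≤ n * d * s := Nat.mul_pos (Nat.mul_pos hn hd) hs
  have hw3 : (A + 20) * (n * d * s) ^ 3 ≤ 2 ^ w :=
    (Nat.mul_le_mul_left _ (Nat.pow_le_pow_right hN (by omega))).trans hw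
  have hNw : 20 * (n * d * s) ≤ 2 ^ w :=
    (Nat.mul_le_mul (by omega) (Nat.le_self_pow (by norm_num) _)).trans hw3
  have hsN : s ≤ n * d * s := Nat.le_mul_of_pos_left _ (Nat.mul_pos hn hd)
  have hndN : n * d ≤ n * d * s := Nat.le_mul_of_pos_right _ hs
  have hnN : n ≤ n * d := Nat.le_mul_of_pos_right _ hd
  have hdN : d ≤ n * d := Nat.le_mul_of_pos_left _ hn
  set m := A * (Nat.log 2 (n * d) + 1) with hm
  have hm0 : 0 < m := Nat.mul_pos hA1 (Nat.succ_pos _)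
  have hrun := fun ω : ℕ → Fin (2 ^ w) => WordRAM.runs_sketchMST (ω := ω)
    (σ := HammingMST.input w p) hn hd hs hA1 hw3
    (Nat.mod_eq_of_lt (show n < 2 ^ w by omega)) (Nat.mod_eq_of_lt (show d < 2 ^ w by omega))
    (Nat.mod_eq_of_lt (show s < 2 ^ w by omega)) rfl
    (fun _ => HammingMST.input_mem_lt p) (fun _ => HammingMST.input_mem_eq_zero p)
  constructor
  · intro ω
    obtain ⟨σ, t, hex, htr, ht⟩ := hrun ω
    exact ⟨σ, t, hex, (Nat.cast_le.2 ht).trans (HammingMST.time_le A hn hd),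
      HammingMST.output_isTree htr⟩
  · have hprob : 1 - 1 / ((n : ℝ) * d) ^ α ≤
        (WordRAM.tapeLaw w).real (HammingMST.goodTapes w p m) := by
      by_cases hnd : 2 ≤ n * d
      · have h1 := HammingMST.le_tapeLaw_goodTapes p (by omega) (by omega : 1 < 2 ^ w) m
        have h2 := HammingMST.failure_le hA hd hnd
        rw [← hm] at h2
        linarith
      -- For nd = 1 the required probability is 0.
      · have h1 : (n : ℝ) * d = 1 := by
          exact_mod_cast (by omega : n * d = 1)
        rw [h1, Real.one_rpow, div_one, sub_self]
        exact MeasureTheory.measureReal_nonneg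
    refine hprob.trans (MeasureTheory.measureReal_mono (fun ω hω => ?_)
      (MeasureTheory.measure_ne_top _ _))
    obtain ⟨σ, t, hex, htr, -⟩ := hrun ω
    have hT := HammingMST.output_isTree htr
    obtain ⟨M, hM⟩ := HammingMST.exists_isMinSpanningTree p hT
    refine ⟨σ, t, hex, hT, M, hM, ?_⟩
    have hcost : HammingMST.cost p (HammingMST.output n σ) ≤ 16 * HammingMST.cost p M :=
      HammingMST.cost_output_le htr (WordRAM.estimate_comm _ _) hm0 (fun x y => (hω x y).1)
        (fun x y => (hω x y).2) hM.1.1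
    have hlog : 0 ≤ Real.logb 2 s := Real.logb_nonneg (by norm_num) (by exact_mod_cast hs)
    calc (HammingMST.cost p (HammingMST.output n σ) : ℝ) ≤ 16 * HammingMST.cost p M := by
          exact_mod_cast hcost
      _ ≤ 16 * (Real.logb 2 s + 1) * HammingMST.cost p M := by
          refine mul_le_mul_of_nonneg_right ?_ (Nat.cast_nonneg _)
          linarith
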